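/- Let $(\Gamma,g)$ be a closed (compact, without boundary) $n$-dimensional Riemannian manifold of class $C^3$, isometrically $C^3$-embedded in the hyperplane $\{x^{N+1}=1\}\subset\mathbb{R}^{N+1}$, and let $K=\{tp : p\in\Gamma,\ t\in\mathbb{R}\}$ be the cone over $\Gamma$ with vertex $O=0$. For $x\in K\setminus\{O\}$ let $T_xK$ be the usual tangent space, put $T_OK:=K$, and let $T^1K=\{(x,v): x\in K,\ v\in T_xK,\ \|v\|=1\}\subset\mathbb{R}^{N+1}\times\mathbb{R}^{N+1}$ with the induced topology. A unit-speed geodesic of $K$ is a $C^2$ curve $\gamma:\mathbb{R}\to K\subset\mathbb{R}^{N+1}$ with $\|\gamma'\|=1$ and $\gamma''(s)\perp T_{\gamma(s)}K$ whenever $\gamma(s)\neq O$; it is radial (a cone generatrix) if $\gamma(s)=(s+c)p$ for some $c\in\mathbb{R}$ and some $p\in K$ with $\|p\|=1$. Let $$\mathcal{T}=\{(x,v)\in T^1K : x\neq kv \text{ for every } k\in\mathbb{R}\}$$ and $I(x,v)=\|x\|^2-\langle x,v\rangle^2/\|v\|^2$, the squared distance from $O$ to the line through $x$ in direction $v$.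 The geodesic flow on $T^1K$ is defined for all times: for each $(x,v)\in T^1K$ there is exactly one unit-speed geodesic $\gamma$ with $\gamma(0)=x$, $\gamma'(0)=v$, and $(\gamma(s),\gamma'(s))\in T^1K$ for all $s\in\mathbb{R}$. There exist continuous functions $I^1,\dots,I^{2N+2}:T^1K\to\mathbb{R}$ that are first integrals of the geodesic flow (constant along $s\mapsto(\gamma(s),\gamma'(s))$ for every unit-speed geodesic $\gamma$) and are $C^1$-smooth on $\mathcal{T}$, such that the map $\mathcal{I}=(I^1,\dots,I^{2N+2}):T^1K\to\mathbb{R}^{2N+2}$ has the following properties. 1. Each point $y\neq 0$ of the image of $\mathcal{I}$ determines a unique geodesic: there is a unit-speed geodesic $\gamma$ such that a unit-speed geodesic $\delta$ has $\mathcal{I}(\delta(0),\delta'(0))=y$ if and only if $\delta(s)=\gamma(s+c)$ for some constant $c$ and all $s$. 2. The origin corresponds exactly to the radial geodesics: a curve $\gamma:\mathbb{R}\to\mathbb{R}^{N+1}$ is a unit-speed geodesic with $\mathcal{I}(\gamma(0),\gamma'(0))=0$ if and only if it is radial. 3. For every non-radial unit-speed geodesic $\gamma$, the value $I=I(\gamma(s),\gamma'(s))$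 is positive and independent of $s$, there is exactly one time $s_0$ at which $\gamma$ touches the sphere of radius $\sqrt{I}$ centred at $O$ (that is, $\|\gamma(s_0)\|=\sqrt I$ and $\langle\gamma(s_0),\gamma'(s_0)\rangle=0$), and along $\gamma$ $$(I^1,\dots,I^{N+1})=I\,\gamma(s_0),\qquad (I^{N+2},\dots,I^{2N+2})=I\,\gamma'(s_0).$$ -/

import Mathlib

open scoped Manifold ContDiff RealInnerProductSpace

namespace ConeGeodesic

/-- The ambient Euclidean space `ℝ^{N+1}`; its coordinates are indexed by `0, …, N`. -/
abbrev Amb (N : ℕ) : Type := EuclideanSpace ℝ (Fin (N + 1))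

section Cone

variable (n : ℕ) {N : ℕ} {M : Type*} [TopologicalSpace M]
  [ChartedSpace (EuclideanSpace ℝ (Fin n)) M]

/-- The differential of `f` at `p`, as a linear map into the ambient space. -/
noncomputable def differential (f : M → Amb N) (p : M) :
    TangentSpace (𝓡 n) p →L[ℝ] Amb N :=
  mfderiv (𝓡 n) 𝓘(ℝ, Amb N) f p

/-- The tangent space of the embedded manifold `f(M)` at `f p`, as a linear subspace of the
ambient space: the image of the differential of `f` at `p`. -/
noncomputable def tangentImage (f : M → Amb N) (p : M) : Submodule ℝ (Amb N) :=
  LinearMap.range (differential n f p).toLinearMap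

/-- `f` is an isometric embedding, of class `C³`, of the closed Riemannian manifold `(M, g)` into
the affine hyperplane `x^{N+1} = 1` of `ℝ^{N+1}`. (On a compact manifold, an injective immersion
is an embedding; the immersion property follows from the isometry property.) -/
structure IsIsometricEmbeddingInPlane {n : ℕ} {M : Type*} [TopologicalSpace M]
    [ChartedSpace (EuclideanSpace ℝ (Fin n)) M] [IsManifold (𝓡 n) 3 M]
    (g : Bundle.ContMDiffRiemannianMetric (𝓡 n) 2 (EuclideanSpace ℝ (Fin n))
      (fun p : M => TangentSpace (𝓡 n) p))
    (f : M → Amb N) : Prop where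
  contMDiff : ContMDiff (𝓡 n) 𝓘(ℝ, Amb N) 3 f
  injective : Function.Injective f
  isometric : ∀ (p : M) (v w : TangentSpace (𝓡 n) p),
    ⟪differential n f p v, differential n f p w⟫ = g.inner p v w
  last_eq_one : ∀ p : M, f p (Fin.last N) = 1

/-- The (two-sided) cone `K = {t p | p ∈ Γ, t ∈ ℝ}` over `Γ = f(M)`. -/
def cone (f : M → Amb N) : Set (Amb N) :=
  {x | ∃ (t : ℝ) (p : M), x = t • f p}

/-- The tangent space of the cone at `x`. At a point `x = t f(p)` with `t ≠ 0` it is the span of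
the generatrix direction `f p` and the tangent space of `Γ` at `f p`; at the vertex it is, by
convention, the cone itself. -/
def tangentCone (f : M → Amb N) (x : Amb N) : Set (Amb N) :=
  {w | (x = 0 ∧ w ∈ cone f) ∨
    ∃ (t : ℝ) (p : M), t ≠ 0 ∧ x = t • f p ∧
      w ∈ Submodule.span ℝ {f p} ⊔ tangentImage n f p}

/-- The unit tangent bundle `T¹K` of the cone, with the topology induced from
`ℝ^{N+1} × ℝ^{N+1}`. -/
def unitTangent (f : M → Amb N) : Set (Amb N × Amb N) :=
  {z | z.1 ∈ cone f ∧ z.2 ∈ tangentCone n f z.1 ∧ ‖z.2‖ = 1}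

/-- The set `𝒯` of non-radial unit tangent vectors. -/
def nonRadial (f : M → Amb N) : Set (Amb N × Amb N) :=
  {z | z ∈ unitTangent n f ∧ ∀ k : ℝ, z.1 ≠ k • z.2}

/-- Unit-speed geodesics of the cone, defined for all times: `C²` curves of unit speed lying on
the cone, whose acceleration is orthogonal to the cone at all points other than the vertex. -/
structure IsUnitGeodesic (f : M → Amb N) (γ : ℝ → Amb N) : Prop where
  contDiff : ContDiff ℝ 2 γ
  mem_cone : ∀ s, γ s ∈ cone f
  unit_speed : ∀ s, ‖deriv γ s‖ = 1
  orthogonal : ∀ s, γ s ≠ 0 → ∀ w ∈ tangentCone n f (γ s), ⟪deriv (deriv γ) s, w⟫ = 0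

/-- The radial geodesics: the cone generatrices, `s ↦ (s + c) p` with `p` a unit vector of the
cone. -/
def IsRadial (f : M → Amb N) (γ : ℝ → Amb N) : Prop :=
  ∃ p ∈ cone f, ‖p‖ = 1 ∧ ∃ c : ℝ, ∀ s, γ s = (s + c) • p

/-- The phase point `(γ(s), γ'(s))` of a curve at time `s`. -/
noncomputable def phase (γ : ℝ → Amb N) (s : ℝ) : Amb N × Amb N := (γ s, deriv γ s)

/-- The geodesic flow `ρ^s` on `T¹K` is well defined for all times: every unit tangent vector is
the initial phase point of exactly one unit-speed geodesic, and phase points of geodesics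
stay in `T¹K`. -/
def FlowWellDefined (f : M → Amb N) : Prop :=
  (∀ z ∈ unitTangent n f, ∃! γ : ℝ → Amb N, IsUnitGeodesic n f γ ∧ phase γ 0 = z) ∧
    ∀ γ : ℝ → Amb N, IsUnitGeodesic n f γ → ∀ s, phase γ s ∈ unitTangent n f

/-- `F` is a first integral of the geodesic flow on `T¹K`: it is constant along
`ρ^s(γ(0), γ'(0)) = (γ(s), γ'(s))`. -/
def IsFirstIntegral (f : M → Amb N) (F : Amb N × Amb N → ℝ) : Prop :=
  ∀ γ : ℝ → Amb N, IsUnitGeodesic n f γ → ∀ s, F (phase γ s) = F (phase γ 0)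

end Cone

/-- `F` is of class `C¹` on a subset `S` (here a submanifold) of Euclidean space: near each point
of `S` it is the restriction to `S` of a `C¹` function on an open subset of the space. -/
def IsC1On {N : ℕ} (F : Amb N × Amb N → ℝ) (S : Set (Amb N × Amb N)) : Prop :=
  ∀ z ∈ S, ∃ (U : Set (Amb N × Amb N)) (G : Amb N × Amb N → ℝ),
    IsOpen U ∧ z ∈ U ∧ ContDiffOn ℝ 1 G U ∧ ∀ y ∈ S ∩ U, F y = G y

/-- `I(x, v) = ‖x‖² - ⟨x, v⟩² / ‖v‖²`, the squared distance from the vertex to the line through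
`x` with direction `v`. -/
noncomputable def distSq {N : ℕ} (z : Amb N × Amb N) : ℝ :=
  ‖z.1‖ ^ 2 - ⟪z.1, z.2⟫ ^ 2 / ‖z.2‖ ^ 2

/-- At time `s` the curve `γ` touches the sphere of radius `r` centred at the vertex. -/
def Touches {N : ℕ} (γ : ℝ → Amb N) (r : ℝ) (s : ℝ) : Prop :=
  ‖γ s‖ = r ∧ ⟪γ s, deriv γ s⟫ = 0

end ConeGeodesic

/-!
The vertex is harmless because of a conservation law. The position vector of a point of the cone is
tangent to the cone, so that `⟪γ'', γ⟫ = 0` along a unit-speed geodesic (trivially so at the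
vertex). With `b = ⟪γ(0), γ'(0)⟫` this gives `⟪γ(s), γ'(s)⟫ = s + b` and `‖γ(s)‖² = (s + b)² + I`,
where `I = distSq` is constant along `γ` (`IsUnitGeodesic.conservation`). If `I = 0`, then `γ` runs
into the vertex at time `-b`, the Cauchy–Schwarz inequality is an equality at all times, and `γ` is
a generatrix (`IsUnitGeodesic.eq_smul_of_eq_zero`). If `I > 0`, then `γ` stays at distance at least
`√I` from the vertex and touches the sphere of radius `√I` exactly at `s₀ = -b`.

The non-radial geodesics thus live in the punctured cone, a submanifold of class `C³`
(`IsIsometricEmbeddingInPlane.hasLocalCharts_cone`). In a chart they are the integral curves of a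
`C¹` vector field, which yields local uniqueness and a local flow that is the restriction of a `C¹`
map of the ambient space (`HasLocalCharts.exists_localFlow`). The flow of a `C¹` field is `C¹` by
the implicit function theorem in the space of curves (`exists_contDiffAt_localFlow`). On a bounded
time interval a geodesic with `I > 0` stays in a compact part of the tangent bundle of the punctured
cone, so that it extends to all times (`exists_isUnitGeodesic_of_distSq_ne_zero`), and the flow at a
fixed time is `C¹` on `𝒯` by composing local flows along the orbit (`exists_contDiffAt_flow`).

The integrals are `I γ(s₀)` and `I γ'(s₀)`, with `s₀ = -⟪x, v⟫` in terms of the initial phase point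
`(x, v)`. They are `C¹` on `𝒯`, and as `‖γ(s₀)‖ = √I` and `‖γ'(s₀)‖ = 1`, the factor `I` makes them
tend to `0` at the radial points. A nonzero value determines `I` as the length of `I γ'(s₀)`, hence
the phase point `(γ(s₀), γ'(s₀))` and the geodesic.
-/

namespace ConeGeodesic

open Filter Topology Set Metric

/-! ### Composition operators on spaces of curves -/

section Nemytskii

variable {I : Type*} [TopologicalSpace I] [CompactSpace I]
  {E F : Type*} [NormedAddCommGroup E] [NormedSpace ℝ E] [NormedAddCommGroup F] [NormedSpace ℝ F]

/-- Pointwise application of a continuous family of operators to a continuous family of vectors,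
as a bounded bilinear map between spaces of continuous functions. -/
noncomputable def pointwiseApply : C(I, E →L[ℝ] F) →L[ℝ] C(I, E) →L[ℝ] C(I, F) :=
  LinearMap.mkContinuous₂
    (LinearMap.mk₂ ℝ (fun (A : C(I, E →L[ℝ] F)) (h : C(I, E)) =>
        (⟨fun s => A s (h s), by fun_prop⟩ : C(I, F)))
      (fun _ _ _ => by ext; simp) (fun _ _ _ => by ext; simp)
      (fun _ _ _ => by ext; simp) (fun _ _ _ => by ext; simp))
    1 (fun A h => by
      rw [ContinuousMap.norm_le _ (by positivity)]
      intro s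
      calc ‖A s (h s)‖ ≤ ‖A s‖ * ‖h s‖ := (A s).le_opNorm _
        _ ≤ 1 * ‖A‖ * ‖h‖ := by
          rw [one_mul]
          gcongr
          · exact A.norm_coe_le_norm s
          · exact h.norm_coe_le_norm s)

/-- Composition with a `C¹` map is a `C¹` operation on continuous functions on a compact space. -/
lemma contDiff_one_postcomp {f : E → F} (hf : ContDiff ℝ 1 f) :
    ContDiff ℝ 1 (fun γ : C(I, E) => (⟨f, hf.continuous⟩ : C(E, F)).comp γ) := by
  have hf' : Continuous (fderiv ℝ f) := hf.continuous_fderiv one_ne_zero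
  have hcont : Continuous fun γ : C(I, E) => (⟨fderiv ℝ f, hf'⟩ : C(E, E →L[ℝ] F)).comp γ :=
    ContinuousMap.continuous_postcomp _
  rw [contDiff_one_iff_hasFDerivAt]
  refine ⟨fun γ => pointwiseApply ((⟨fderiv ℝ f, hf'⟩ : C(E, E →L[ℝ] F)).comp γ),
    pointwiseApply.continuous.comp hcont, fun γ => ?_⟩
  rw [hasFDerivAt_iff_isLittleO, Asymptotics.isLittleO_iff]
  intro c hc
  obtain ⟨δ, hδ, hball⟩ := (@Metric.continuous_iff C(I, E) C(I, E →L[ℝ] F) _ _ _).1 hcont γ c hc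
  filter_upwards [ball_mem_nhds γ hδ] with η hη
  rw [ContinuousMap.norm_le _ (by positivity)]
  intro s
  have hseg : ∀ x ∈ segment ℝ (γ s) (η s), ‖fderiv ℝ f x - fderiv ℝ f (γ s)‖ ≤ c := by
    rintro x hx
    rw [segment_eq_image'] at hx
    obtain ⟨θ, hθ, rfl⟩ := hx
    have h1 : dist (γ + θ • (η - γ)) γ < δ := by
      rw [dist_eq_norm, add_sub_cancel_left, norm_smul, Real.norm_of_nonneg hθ.1]
      refine lt_of_le_of_lt ?_ (mem_ball_iff_norm.1 hη)
      exact mul_le_of_le_one_left (norm_nonneg _) hθ.2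
    have h2 := (ContinuousMap.dist_lt_iff hc).1 (hball _ h1) s
    rw [dist_eq_norm] at h2
    exact h2.le
  have h := (convex_segment (γ s) (η s)).norm_image_sub_le_of_norm_hasFDerivWithin_le'
    (fun x _ => ((hf.differentiable one_ne_zero) x).hasFDerivAt.hasFDerivWithinAt) hseg
    (left_mem_segment ℝ _ _) (right_mem_segment ℝ _ _)
  refine h.trans ?_
  gcongr
  exact (η - γ).norm_coe_le_norm s

/-- The constant functions, as a bounded linear map into the space of continuous functions. -/
noncomputable def constCurve : E →L[ℝ] C(I, E) :=
  LinearMap.mkContinuous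
    { toFun := fun x => ContinuousMap.const I x
      map_add' := fun _ _ => rfl
      map_smul' := fun _ _ => rfl }
    1 (fun x => by
      rw [ContinuousMap.norm_le _ (by positivity)]
      intro s
      rw [one_mul]
      exact le_rfl)

end Nemytskii

/-! ### The local flow of a `C¹` vector field -/

section Flow

variable {E : Type*} [NormedAddCommGroup E] [NormedSpace ℝ E]

/-- The Volterra operator `γ ↦ (s ↦ ∫₀ˢ γ)` on `C([0, 1], E)`. -/
noncomputable def volterra : C(Icc (0 : ℝ) 1, E) →L[ℝ] C(Icc (0 : ℝ) 1, E) :=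
  LinearMap.mkContinuous
    { toFun := fun γ => ⟨fun s => ∫ r in (0 : ℝ)..s, IccExtend zero_le_one γ r,
        (intervalIntegral.continuous_primitive
          (fun _ _ => (γ.continuous.Icc_extend').intervalIntegrable _ _) 0).comp
          continuous_subtype_val⟩
      map_add' := fun γ η => by
        ext s
        simp only [ContinuousMap.coe_mk, ContinuousMap.add_apply]
        rw [← intervalIntegral.integral_add
          ((γ.continuous.Icc_extend').intervalIntegrable _ _)
          ((η.continuous.Icc_extend').intervalIntegrable _ _)]
        rfl
      map_smul' := fun c γ => by
        ext s
        simp only [ContinuousMap.coe_mk, ContinuousMap.smul_apply, RingHom.id_apply]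
        rw [← intervalIntegral.integral_smul]
        rfl }
    1 (fun γ => by
      rw [ContinuousMap.norm_le _ (by positivity)]
      intro s
      have h := intervalIntegral.norm_integral_le_of_norm_le_const (a := (0 : ℝ)) (b := s)
        (f := IccExtend zero_le_one γ) (C := ‖γ‖) (fun r _ => γ.norm_coe_le_norm _)
      refine h.trans ?_
      rw [sub_zero, abs_of_nonneg s.2.1, mul_comm]
      gcongr
      exact s.2.2)

variable [FiniteDimensional ℝ E]

/-- A map that is `C¹` at a point agrees near that point with a map that is `C¹` everywhere. -/
lemma exists_contDiff_eventuallyEq {X : E → E} {x₀ : E} (hX : ContDiffAt ℝ 1 X x₀) :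
    ∃ Y : E → E, ContDiff ℝ 1 Y ∧ Y =ᶠ[𝓝 x₀] X := by
  obtain ⟨δ, hδ, hball⟩ := Metric.eventually_nhds_iff_ball.1 (hX.eventually (by simp))
  let χ : ContDiffBump x₀ := ⟨δ / 4, δ / 2, by positivity, by linarith⟩
  refine ⟨fun x => χ x • X x, ?_, ?_⟩
  · rw [contDiff_iff_contDiffAt]
    intro x
    by_cases hx : x ∈ ball x₀ δ
    · exact χ.contDiff.contDiffAt.smul (hball x hx)
    · have : x ∉ tsupport χ := by
        rw [χ.tsupport_eq]
        simp only [mem_ball, not_lt, mem_closedBall, not_le] at hx ⊢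
        change δ / 2 < _
        linarith
      have h0 : (fun x => χ x • X x) =ᶠ[𝓝 x] fun _ => 0 := by
        filter_upwards [notMem_tsupport_iff_eventuallyEq.1 this] with y hy
        simp [hy]
      exact contDiffAt_const.congr_of_eventuallyEq h0
  · filter_upwards [χ.eventuallyEq_one] with x hx
    simp [hx]

/-- The local flow of a `C¹` vector field is jointly `C¹` in the initial point and time.

A rescaled integral curve `s ↦ Φ(x, ts)`, `s ∈ [0, 1]`, is a zero of the `C¹` map
`((x, t), γ) ↦ γ - x - t ∫₀ X ∘ γ` on `(E × ℝ) × C([0, 1], E)`. At `t = 0` the derivative of this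
map in `γ` is the identity, so that the implicit function theorem applies. -/
theorem exists_contDiffAt_localFlow {X : E → E} {x₀ : E} (hX : ContDiffAt ℝ 1 X x₀) :
    ∃ Φ : E × ℝ → E, ContDiffAt ℝ 1 Φ (x₀, 0) ∧ ∃ r > 0, ∃ ε > 0, ∀ x ∈ ball x₀ r,
      Φ (x, 0) = x ∧ ∀ t ∈ Ioo (-ε) ε, HasDerivAt (fun t => Φ (x, t)) (X (Φ (x, t))) t := by
  have : CompleteSpace E := FiniteDimensional.complete ℝ E
  obtain ⟨Y, hY, hYX⟩ := exists_contDiff_eventuallyEq hX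
  obtain ⟨ρ, hρ, hYXball⟩ := Metric.eventually_nhds_iff_ball.1 hYX
  obtain ⟨ε, hε, a, r, L, K, hr, hpl⟩ := IsPicardLindelof.of_contDiffAt_one hX
  obtain ⟨Φ, hΦ, hΦc⟩ :=
    (hpl 0).exists_forall_mem_closedBall_eq_hasDerivWithinAt_continuousOn
  simp only [zero_sub, zero_add] at hΦ hΦc
  have hr' : (0 : ℝ) < r := hr
  have hderiv : ∀ x ∈ closedBall x₀ r, ∀ t ∈ Ioo (-ε) ε,
      HasDerivAt (fun t => Φ (x, t)) (X (Φ (x, t))) t := fun x hx t ht =>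
    ((hΦ x hx).2 t (Ioo_subset_Icc_self ht)).hasDerivAt (Icc_mem_nhds ht.1 ht.2)
  refine ⟨Φ, ?_, r, hr', ε, hε, fun x hx =>
    ⟨(hΦ x (ball_subset_closedBall hx)).1, hderiv x (ball_subset_closedBall hx)⟩⟩
  -- the defining equation of rescaled integral curves
  let Ψ : (E × ℝ) × C(Icc (0 : ℝ) 1, E) → C(Icc (0 : ℝ) 1, E) := fun q =>
    q.2 - constCurve q.1.1 - q.1.2 • volterra ((⟨Y, hY.continuous⟩ : C(E, E)).comp q.2)
  have hΨ : ContDiff ℝ 1 Ψ := by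
    have h1 := (contDiff_one_postcomp (I := Icc (0 : ℝ) 1) hY).comp
      (contDiff_snd : ContDiff ℝ 1 (Prod.snd : (E × ℝ) × C(Icc (0 : ℝ) 1, E) → _))
    have h2 := (volterra (E := E)).contDiff.comp h1
    have h3 := (constCurve (I := Icc (0 : ℝ) 1) (E := E)).contDiff.comp
      (contDiff_fst.comp contDiff_fst :
        ContDiff ℝ 1 (fun q : (E × ℝ) × C(Icc (0 : ℝ) 1, E) => q.1.1))
    exact (contDiff_snd.sub h3).sub ((contDiff_snd.comp contDiff_fst).smul h2)
  let u : (E × ℝ) × C(Icc (0 : ℝ) 1, E) := ((x₀, 0), constCurve x₀)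
  have hΨu : Ψ u = 0 := by simp [Ψ, u]
  have hinr : fderiv ℝ Ψ u ∘L .inr ℝ (E × ℝ) C(Icc (0 : ℝ) 1, E)
      = ContinuousLinearMap.id ℝ _ := by
    have h1 : HasFDerivAt (fun γ => Ψ ((x₀, 0), γ))
        (fderiv ℝ Ψ u ∘L .inr ℝ (E × ℝ) C(Icc (0 : ℝ) 1, E)) (constCurve x₀) :=
      ((hΨ.differentiable one_ne_zero) u).hasFDerivAt.comp (constCurve x₀)
        (hasFDerivAt_prodMk_right (x₀, (0 : ℝ)) (constCurve x₀))
    have h2 : HasFDerivAt (fun γ => Ψ ((x₀, 0), γ))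
        (ContinuousLinearMap.id ℝ _) (constCurve x₀) := by
      simpa [Ψ] using (hasFDerivAt_id (𝕜 := ℝ)
        (constCurve x₀ : C(Icc (0 : ℝ) 1, E))).sub_const (constCurve x₀)
    exact h1.unique h2
  have hinv : (fderiv ℝ Ψ u ∘L .inr ℝ (E × ℝ) C(Icc (0 : ℝ) 1, E)).IsInvertible := by
    rw [hinr]
    exact ⟨ContinuousLinearEquiv.refl ℝ _, rfl⟩
  have hΨ1 : ContDiffAt ℝ 1 Ψ u := hΨ.contDiffAt
  let ψ := hΨ1.implicitFunction one_ne_zero hinv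
  have hψ : ContDiffAt ℝ 1 ψ (x₀, 0) := hΨ1.contDiffAt_implicitFunction one_ne_zero hinv
  have hiff := hΨ1.eventually_apply_eq_iff_implicitFunction one_ne_zero hinv
  rw [nhds_prod_eq, eventually_prod_iff] at hiff
  obtain ⟨P, hP, Q, hQ, hPQ⟩ := hiff
  obtain ⟨δ, hδ, hQball⟩ := Metric.eventually_nhds_iff_ball.1 hQ
  -- near `(x₀, 0)` the flow stays where `Y = X` and close to the constant curve
  have hcont : ContinuousAt Φ (x₀, 0) := hΦc.continuousAt
    (prod_mem_nhds (closedBall_mem_nhds x₀ hr') (Icc_mem_nhds (by linarith) hε))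
  have hΦ0 : Φ (x₀, 0) = x₀ := (hΦ x₀ (mem_closedBall_self hr'.le)).1
  have hnear : ∀ᶠ p in 𝓝 (x₀, (0 : ℝ)), Φ p ∈ ball x₀ (min δ ρ) := by
    have := hcont.tendsto
    rw [hΦ0] at this
    exact this (ball_mem_nhds _ (lt_min hδ hρ))
  obtain ⟨η, hη, hnear⟩ := Metric.eventually_nhds_iff_ball.1 hnear
  have hcurve : ∀ᶠ p in 𝓝 (x₀, (0 : ℝ)), Φ p = ψ p ⟨1, by simp⟩ := by
    filter_upwards [hP, ball_mem_nhds (x₀, (0 : ℝ)) (lt_min hη (lt_min hε hr'))]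
      with ⟨x, t⟩ hPp hp
    rw [← ball_prod_same, mem_prod] at hp
    obtain ⟨hx, ht⟩ := hp
    simp only [mem_ball, dist_zero_right, Real.norm_eq_abs, lt_min_iff] at hx ht
    have hxr : x ∈ closedBall x₀ r := hx.2.2.le
    have habs : ∀ s ∈ Icc (0 : ℝ) 1, |t * s| ≤ |t| := fun s hs => by
      rw [abs_mul, abs_of_nonneg hs.1]
      exact mul_le_of_le_one_right (abs_nonneg _) hs.2
    have hts : ∀ s ∈ Icc (0 : ℝ) 1, t * s ∈ Ioo (-ε) ε := fun s hs =>
      abs_lt.1 ((habs s hs).trans_lt ht.2.1)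
    have hmem : ∀ s ∈ Icc (0 : ℝ) 1, Φ (x, t * s) ∈ ball x₀ (min δ ρ) := fun s hs => by
      apply hnear
      rw [← ball_prod_same]
      refine ⟨hx.1, ?_⟩
      rw [mem_ball_zero_iff, Real.norm_eq_abs]
      exact (habs s hs).trans_lt ht.1
    have hd : ∀ s ∈ Icc (0 : ℝ) 1,
        HasDerivAt (fun s => Φ (x, t * s)) (t • Y (Φ (x, t * s))) s := fun s hs => by
      rw [hYXball _ (ball_subset_ball (min_le_right _ _) (hmem s hs))]
      have h1 : HasDerivAt (fun s : ℝ => t * s) t s := by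
        simpa using (hasDerivAt_id s).const_mul t
      exact (hderiv x hxr _ (hts s hs)).scomp s h1
    let γ : C(Icc (0 : ℝ) 1, E) := ⟨fun s => Φ (x, t * s), by
      rw [continuous_iff_continuousAt]
      intro s
      exact (hd s s.2).continuousAt.comp continuous_subtype_val.continuousAt⟩
    have hγ : γ ∈ ball (constCurve x₀) δ := by
      rw [mem_ball, ContinuousMap.dist_lt_iff hδ]
      intro s
      exact (ball_subset_ball (min_le_left _ _) (hmem s s.2))
    have hzero : Ψ ((x, t), γ) = 0 := by
      ext s
      have hint : ∫ y in (0 : ℝ)..s, t • IccExtend zero_le_one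
          ((⟨Y, hY.continuous⟩ : C(E, E)).comp γ) y = Φ (x, t * s) - Φ (x, t * 0) := by
        apply intervalIntegral.integral_eq_sub_of_hasDerivAt (f := fun s => Φ (x, t * s))
        · intro y hy
          rw [uIcc_of_le s.2.1] at hy
          have hy1 : y ∈ Icc (0 : ℝ) 1 := ⟨hy.1, hy.2.trans s.2.2⟩
          rw [IccExtend_of_mem _ _ hy1]
          exact hd y hy1
        · exact (((ContinuousMap.continuous _).Icc_extend').const_smul t).intervalIntegrable _ _
      rw [intervalIntegral.integral_smul, mul_zero, (hΦ x hxr).1] at hint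
      have : Ψ ((x, t), γ) s = Φ (x, t * s) - x - t • ∫ y in (0 : ℝ)..s, IccExtend zero_le_one
          ((⟨Y, hY.continuous⟩ : C(E, E)).comp γ) y := rfl
      rw [this, hint]
      simp
    have := (hPQ hPp (hQball γ hγ)).1 (by rw [hzero, hΨu])
    change ψ (x, t) = γ at this
    rw [this]
    simp [γ]
  refine ContDiffAt.congr_of_eventuallyEq ?_ hcurve
  exact (ContinuousMap.evalCLM ℝ (⟨1, by simp⟩ : Icc (0 : ℝ) 1)).contDiff.contDiffAt.comp _ hψ

end Flow

/-! ### The geodesic vector field in a parametrization -/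

section TangentLift

variable {E F : Type*} [NormedAddCommGroup E] [NormedSpace ℝ E]
  [NormedAddCommGroup F] [NormedSpace ℝ F]

/-- The tangent map `(u, ξ) ↦ (φ u, Dφ(u) ξ)` of a map between vector spaces. -/
noncomputable def tangentLift (φ : F → E) (y : F × F) : E × E := (φ y.1, fderiv ℝ φ y.1 y.2)

lemma contDiffAt_tangentLift {φ : F → E} {y : F × F} (h : ContDiffAt ℝ 3 φ y.1) :
    ContDiffAt ℝ 2 (tangentLift φ) y := by
  have h1 : ContDiffAt ℝ 2 (fderiv ℝ φ) y.1 := h.fderiv_right (by norm_num)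
  have h2 : ContDiffAt ℝ 2 φ y.1 := h.of_le (by norm_num)
  exact (h2.comp y contDiffAt_fst).prodMk ((h1.comp y contDiffAt_fst).clm_apply contDiffAt_snd)

lemma hasDerivAt_tangentLift {φ : F → E} {y : ℝ → F × F} {s : ℝ} {y' : F × F}
    (h : ContDiffAt ℝ 3 φ (y s).1) (hy : HasDerivAt y y' s) :
    HasDerivAt (fun t => tangentLift φ (y t))
      (fderiv ℝ φ (y s).1 y'.1,
        fderiv ℝ (fderiv ℝ φ) (y s).1 y'.1 (y s).2 + fderiv ℝ φ (y s).1 y'.2) s := by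
  have h1 : ContDiffAt ℝ 2 (fderiv ℝ φ) (y s).1 := h.fderiv_right (by norm_num)
  have hy1 : HasDerivAt (fun t => (y t).1) y'.1 s := 
    (hasFDerivAt_fst (𝕜 := ℝ) (p := y s)).comp_hasDerivAt s hy
  have hy2 : HasDerivAt (fun t => (y t).2) y'.2 s := 
    (hasFDerivAt_snd (𝕜 := ℝ) (p := y s)).comp_hasDerivAt s hy
  have hφ := (h.differentiableAt (by norm_num)).hasFDerivAt.comp_hasDerivAt s hy1
  have hDφ := (h1.differentiableAt (by norm_num)).hasFDerivAt.comp_hasDerivAt s hy1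
  exact hφ.prodMk (hDφ.clm_apply hy2)

end TangentLift

section GeodesicField

variable {E F : Type*} [NormedAddCommGroup E] [InnerProductSpace ℝ E]
  [NormedAddCommGroup F] [NormedSpace ℝ F]

/-- The first fundamental form of the parametrization `φ` at `u`. -/
noncomputable def firstForm (φ : F → E) (u : F) : F →L[ℝ] F →L[ℝ] ℝ :=
  ((ContinuousLinearMap.compL ℝ F E ℝ).flip (fderiv ℝ φ u)) ∘L
    ((innerSL ℝ : E →L[ℝ] E →L[ℝ] ℝ) ∘L fderiv ℝ φ u)

@[simp] lemma firstForm_apply (φ : F → E) (u ξ η : F) :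
    firstForm φ u ξ η = ⟪fderiv ℝ φ u ξ, fderiv ℝ φ u η⟫ := rfl

/-- The geodesic vector field `(u, ξ) ↦ (ξ, -Γ(u)(ξ, ξ))` of the submanifold parametrized by `φ`,
in the coordinates of `φ`; the Christoffel term is written with the inverse of the first
fundamental form applied to the functional `⟪D²φ(u)(ξ, ξ), Dφ(u) ·⟫`. -/
noncomputable def geodesicField (φ : F → E) (y : F × F) : F × F :=
  (y.2, -(firstForm φ y.1).inverse
    ((innerSL ℝ : E →L[ℝ] E →L[ℝ] ℝ) (fderiv ℝ (fderiv ℝ φ) y.1 y.2 y.2) ∘L fderiv ℝ φ y.1))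

variable [FiniteDimensional ℝ F]

lemma isInvertible_firstForm {φ : F → E} {u : F}
    (h : Function.Injective (fderiv ℝ φ u)) : (firstForm φ u).IsInvertible := by
  have hinj : Function.Injective (firstForm φ u).toLinearMap := by
    rw [injective_iff_map_eq_zero]
    intro ξ hξ
    have h1 : firstForm φ u ξ ξ = 0 := by
      have := congrArg (fun l : F →L[ℝ] ℝ => l ξ) hξ
      simpa using this
    rw [firstForm_apply, inner_self_eq_zero] at h1
    exact (injective_iff_map_eq_zero _).1 h ξ h1
  have hfin : FiniteDimensional ℝ (F →L[ℝ] ℝ) :=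
    (LinearMap.toContinuousLinearMap (𝕜 := ℝ) (E := F) (F' := ℝ)).finiteDimensional
  have hdim : Module.finrank ℝ F = Module.finrank ℝ (F →L[ℝ] ℝ) := by
    rw [← (LinearMap.toContinuousLinearMap (𝕜 := ℝ) (E := F) (F' := ℝ)).finrank_eq]
    exact (Subspace.dual_finrank_eq (K := ℝ) (V := F)).symm
  refine ⟨(LinearEquiv.ofInjectiveOfFinrankEq _ hinj hdim).toContinuousLinearEquiv, ?_⟩
  ext
  rfl

/-- The geodesic equation in coordinates: the acceleration `D²φ(ξ, ξ) + Dφ ζ` is orthogonal to the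
submanifold exactly when `ζ` is prescribed by the geodesic vector field. -/
lemma forall_inner_eq_zero_iff_geodesicField {φ : F → E} {u : F}
    (h : Function.Injective (fderiv ℝ φ u)) (ξ ζ : F) :
    (∀ η, ⟪fderiv ℝ (fderiv ℝ φ) u ξ ξ + fderiv ℝ φ u ζ, fderiv ℝ φ u η⟫ = 0) ↔
      ζ = (geodesicField φ (u, ξ)).2 := by
  obtain ⟨e, he⟩ := isInvertible_firstForm h
  set l : F →L[ℝ] ℝ :=
    (innerSL ℝ : E →L[ℝ] E →L[ℝ] ℝ) (fderiv ℝ (fderiv ℝ φ) u ξ ξ) ∘L fderiv ℝ φ u with hl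
  have h1 : (geodesicField φ (u, ξ)).2 = -e.symm l := by
    simp only [geodesicField, ← he, ContinuousLinearMap.inverse_equiv]
    rfl
  have h2 : (∀ η, ⟪fderiv ℝ (fderiv ℝ φ) u ξ ξ + fderiv ℝ φ u ζ, fderiv ℝ φ u η⟫ = 0) ↔
      l + e ζ = 0 := by
    rw [ContinuousLinearMap.ext_iff]
    refine forall_congr' fun η => ?_
    have : e ζ = firstForm φ u ζ := by rw [← he]; rfl
    rw [this, inner_add_left]
    rfl
  rw [h2, h1, ← map_neg, ContinuousLinearEquiv.eq_symm_apply, eq_neg_iff_add_eq_zero, add_comm]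

-- the nested operator spaces need a deeper instance search
set_option maxSynthPendingDepth 4 in
lemma contDiffAt_geodesicField {φ : F → E} {y : F × F} (h : ContDiffAt ℝ 3 φ y.1)
    (hinj : Function.Injective (fderiv ℝ φ y.1)) : ContDiffAt ℝ 1 (geodesicField φ) y := by
  have : CompleteSpace F := FiniteDimensional.complete ℝ F
  have hD : ContDiffAt ℝ 2 (fderiv ℝ φ) y.1 := h.fderiv_right (by norm_num)
  have hD1 : ContDiffAt ℝ 1 (fun y : F × F => fderiv ℝ φ y.1) y :=
    (hD.of_le (by norm_num)).comp y contDiffAt_fst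
  have hDD : ContDiffAt ℝ 1 (fun y : F × F => fderiv ℝ (fderiv ℝ φ) y.1) y :=
    (hD.fderiv_right (m := 1) (by norm_num)).comp y contDiffAt_fst
  have hG : ContDiffAt ℝ 1 (fun y : F × F => firstForm φ y.1) y :=
    ContDiffAt.clm_comp
      (ContDiffAt.clm_apply (contDiffAt_const (c := (ContinuousLinearMap.compL ℝ F E ℝ).flip)) hD1)
      (ContDiffAt.clm_comp (contDiffAt_const (c := (innerSL ℝ : E →L[ℝ] E →L[ℝ] ℝ))) hD1)
  have hinv : ContDiffAt ℝ 1 (fun y : F × F => (firstForm φ y.1).inverse) y :=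
    ContDiffAt.comp (g := ContinuousLinearMap.inverse) y
      (isInvertible_firstForm hinj).contDiffAt_map_inverse hG
  have hacc : ContDiffAt ℝ 1 (fun y : F × F => fderiv ℝ (fderiv ℝ φ) y.1 y.2 y.2) y :=
    (hDD.clm_apply contDiffAt_snd).clm_apply contDiffAt_snd
  have hl : ContDiffAt ℝ 1 (fun y : F × F => (innerSL ℝ : E →L[ℝ] E →L[ℝ] ℝ)
      (fderiv ℝ (fderiv ℝ φ) y.1 y.2 y.2) ∘L fderiv ℝ φ y.1) y :=
    ((innerSL ℝ : E →L[ℝ] E →L[ℝ] ℝ).contDiff.contDiffAt.comp y hacc).clm_comp hD1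
  exact contDiffAt_snd.prodMk (hinv.clm_apply hl).neg

end GeodesicField

/-! ### Submanifolds and their tangent bundles -/

section LocalChart

variable {E F : Type*} [NormedAddCommGroup E] [InnerProductSpace ℝ E]
  [NormedAddCommGroup F] [NormedSpace ℝ F]

/-- A local chart of class `C³` of a set `W ⊆ E` with tangent spaces `T`: a parametrization `φ`
of the part of `W` inside the open set `V`, whose inverse is the restriction of a `C³` map `ψ`
defined on all of `V`. -/
structure LocalChart (W : Set E) (T : E → Set E) (φ : F → E) (ψ : E → F) (U : Set F)
    (V : Set E) : Prop where
  isOpen_source : IsOpen U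
  isOpen_target : IsOpen V
  contDiffOn_param : ContDiffOn ℝ 3 φ U
  contDiffOn_coord : ContDiffOn ℝ 3 ψ V
  mapsTo : ∀ u ∈ U, φ u ∈ W ∩ V
  left_inv : ∀ u ∈ U, ψ (φ u) = u
  right_inv : ∀ w ∈ W ∩ V, ψ w ∈ U ∧ φ (ψ w) = w
  tangent : ∀ u ∈ U, T (φ u) = range (fderiv ℝ φ u)

/-- `W` with the tangent spaces `T` is a submanifold of `E` of class `C³`, modelled on `F`. -/
def HasLocalCharts (F : Type*) [NormedAddCommGroup F] [NormedSpace ℝ F] (W : Set E)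
    (T : E → Set E) : Prop :=
  ∀ x ∈ W, ∃ (φ : F → E) (ψ : E → F) (U : Set F) (V : Set E), x ∈ V ∧ LocalChart W T φ ψ U V

/-- The tangent bundle of the submanifold `W` with tangent spaces `T`. -/
def tangentBundle (W : Set E) (T : E → Set E) : Set (E × E) := {z | z.1 ∈ W ∧ z.2 ∈ T z.1}

variable {W : Set E} {T : E → Set E} {φ : F → E} {ψ : E → F} {U : Set F} {V : Set E}

namespace LocalChart

lemma contDiffAt_param (h : LocalChart W T φ ψ U V) {u : F} (hu : u ∈ U) : ContDiffAt ℝ 3 φ u :=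
  h.contDiffOn_param.contDiffAt (h.isOpen_source.mem_nhds hu)

lemma contDiffAt_coord (h : LocalChart W T φ ψ U V) {x : E} (hx : x ∈ V) : ContDiffAt ℝ 3 ψ x :=
  h.contDiffOn_coord.contDiffAt (h.isOpen_target.mem_nhds hx)

lemma fderiv_coord_comp_fderiv_param (h : LocalChart W T φ ψ U V) {u : F} (hu : u ∈ U) (ξ : F) :
    fderiv ℝ ψ (φ u) (fderiv ℝ φ u ξ) = ξ := by
  have h1 := ((h.contDiffAt_coord (h.mapsTo u hu).2).differentiableAt
    (by norm_num)).hasFDerivAt.comp u ((h.contDiffAt_param hu).differentiableAt (by norm_num)).hasFDerivAt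
  have h2 : HasFDerivAt (ψ ∘ φ) (ContinuousLinearMap.id ℝ F) u := by
    refine (hasFDerivAt_id u).congr_of_eventuallyEq ?_
    filter_upwards [h.isOpen_source.mem_nhds hu] with v hv
    exact h.left_inv v hv
  simpa using congrArg (fun l : F →L[ℝ] F => l ξ) (h1.unique h2)

lemma injective_fderiv_param (h : LocalChart W T φ ψ U V) {u : F} (hu : u ∈ U) :
    Function.Injective (fderiv ℝ φ u) :=
  Function.LeftInverse.injective (h.fderiv_coord_comp_fderiv_param hu)

lemma tangentLift_param_mem (h : LocalChart W T φ ψ U V) {y : F × F} (hy : y.1 ∈ U) :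
    tangentLift φ y ∈ tangentBundle W T :=
  ⟨(h.mapsTo _ hy).1, by
    change _ ∈ T (φ y.1)
    rw [h.tangent _ hy]
    exact mem_range_self _⟩

lemma tangentLift_param_coord (h : LocalChart W T φ ψ U V) {z : E × E}
    (hz : z ∈ tangentBundle W T) (hV : z.1 ∈ V) : tangentLift φ (tangentLift ψ z) = z := by
  obtain ⟨x, v⟩ := z
  obtain ⟨hU, hx⟩ := h.right_inv x ⟨hz.1, hV⟩
  have hv : v ∈ T (φ (ψ x)) := by rw [hx]; exact hz.2
  rw [h.tangent _ hU] at hv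
  obtain ⟨ξ, hξ⟩ := hv
  have h1 := h.fderiv_coord_comp_fderiv_param hU ξ
  rw [hξ, hx] at h1
  simp only [tangentLift, hx, h1, hξ]

end LocalChart

/-- A point of the closure of the tangent bundle that lies over `W` belongs to the tangent
bundle. -/
lemma HasLocalCharts.mem_tangentBundle_of_mem_closure (hW : HasLocalCharts F W T) {z : E × E}
    (hz : z ∈ closure (tangentBundle W T)) (hzW : z.1 ∈ W) : z ∈ tangentBundle W T := by
  obtain ⟨φ, ψ, U, V, hV, hc⟩ := hW z.1 hzW
  obtain ⟨hU, -⟩ := hc.right_inv z.1 ⟨hzW, hV⟩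
  have hψ : ContinuousAt (tangentLift ψ) z :=
    (contDiffAt_tangentLift (hc.contDiffAt_coord hV)).continuousAt
  have hφ : ContinuousAt (tangentLift φ) (tangentLift ψ z) :=
    (contDiffAt_tangentLift (y := tangentLift ψ z) (hc.contDiffAt_param hU)).continuousAt
  have : (𝓝[tangentBundle W T] z).NeBot := mem_closure_iff_nhdsWithin_neBot.1 hz
  have h1 : Tendsto (fun z => tangentLift φ (tangentLift ψ z)) (𝓝[tangentBundle W T] z)
      (𝓝 (tangentLift φ (tangentLift ψ z))) :=
    (ContinuousAt.comp hφ hψ).tendsto.mono_left nhdsWithin_le_nhds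
  have h2 : Tendsto (fun z => tangentLift φ (tangentLift ψ z)) (𝓝[tangentBundle W T] z)
      (𝓝 z) := by
    refine (tendsto_id.mono_left nhdsWithin_le_nhds).congr' ?_
    have hev : ∀ᶠ w in 𝓝[tangentBundle W T] z, w.1 ∈ V :=
      (continuous_fst.continuousAt.eventually_mem (hc.isOpen_target.mem_nhds hV)).filter_mono
        nhdsWithin_le_nhds
    filter_upwards [hev, self_mem_nhdsWithin] with w hw hwT
    exact (hc.tangentLift_param_coord hwT hw).symm
  have h3 := tendsto_nhds_unique h1 h2
  rw [← h3]
  exact hc.tangentLift_param_mem hU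

/-- The velocity of a curve in a submanifold is a tangent vector. -/
lemma HasLocalCharts.mem_tangent_of_hasDerivAt (hW : HasLocalCharts F W T) {γ : ℝ → E} {s : ℝ}
    {v : E} (hγ : HasDerivAt γ v s) (hmem : ∀ᶠ t in 𝓝 s, γ t ∈ W) : v ∈ T (γ s) := by
  have hs : γ s ∈ W := hmem.self_of_nhds
  obtain ⟨φ, ψ, U, V, hV, hc⟩ := hW (γ s) hs
  obtain ⟨hU, hx⟩ := hc.right_inv (γ s) ⟨hs, hV⟩
  have h1 := ((hc.contDiffAt_coord hV).differentiableAt (by norm_num)).hasFDerivAt.comp_hasDerivAt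
    s hγ
  have h2 := ((hc.contDiffAt_param hU).differentiableAt
    (by norm_num)).hasFDerivAt.comp_hasDerivAt (f := ψ ∘ γ) s h1
  have h3 : HasDerivAt (φ ∘ ψ ∘ γ) v s := by
    refine hγ.congr_of_eventuallyEq ?_
    filter_upwards [hmem, hγ.continuousAt.eventually_mem (hc.isOpen_target.mem_nhds hV)]
      with t ht htV
    exact (hc.right_inv _ ⟨ht, htV⟩).2
  have h4 := hc.tangent _ hU
  rw [hx] at h4
  rw [h4, h3.unique h2]
  exact mem_range_self _

end LocalChart

/-! ### Geodesics of a submanifold -/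

section GeodesicCurves

variable {E F : Type*} [NormedAddCommGroup E] [InnerProductSpace ℝ E]
  [NormedAddCommGroup F] [NormedSpace ℝ F]
  {W : Set E} {T : E → Set E} {φ : F → E} {ψ : E → F} {U : Set F} {V : Set E}

/-- The phase curve `z = (x, v)` satisfies the geodesic equation of the submanifold `W` with tangent
spaces `T` at time `s`: it is `C¹`, lies in the tangent bundle, and satisfies `x' = v`,
`v' ⊥ T x`. -/
structure IsGeodesicAt (W : Set E) (T : E → Set E) (z : ℝ → E × E) (s : ℝ) : Prop where
  mem : z s ∈ tangentBundle W T
  contDiffAt : ContDiffAt ℝ 1 z s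
  deriv_fst : (deriv z s).1 = (z s).2
  orthogonal : ∀ w ∈ T (z s).1, ⟪(deriv z s).2, w⟫ = 0

lemma IsGeodesicAt.hasDerivAt {z : ℝ → E × E} {s : ℝ} (h : IsGeodesicAt W T z s) :
    HasDerivAt z (deriv z s) s :=
  (h.contDiffAt.differentiableAt one_ne_zero).hasDerivAt

lemma IsGeodesicAt.hasDerivAt_fst {z : ℝ → E × E} {s : ℝ} (h : IsGeodesicAt W T z s) :
    HasDerivAt (fun t => (z t).1) (z s).2 s := by
  rw [← h.deriv_fst]
  exact (hasFDerivAt_fst (𝕜 := ℝ) (p := z s)).comp_hasDerivAt s h.hasDerivAt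

lemma IsGeodesicAt.hasDerivAt_snd {z : ℝ → E × E} {s : ℝ} (h : IsGeodesicAt W T z s) :
    HasDerivAt (fun t => (z t).2) (deriv z s).2 s :=
  (hasFDerivAt_snd (𝕜 := ℝ) (p := z s)).comp_hasDerivAt s h.hasDerivAt

lemma IsGeodesicAt.congr {z w : ℝ → E × E} {s : ℝ} (h : IsGeodesicAt W T z s)
    (hzw : w =ᶠ[𝓝 s] z) : IsGeodesicAt W T w s where
  mem := by rw [hzw.self_of_nhds]; exact h.mem
  contDiffAt := h.contDiffAt.congr_of_eventuallyEq hzw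
  deriv_fst := by rw [hzw.deriv_eq, hzw.self_of_nhds]; exact h.deriv_fst
  orthogonal := by rw [hzw.deriv_eq, hzw.self_of_nhds]; exact h.orthogonal

lemma IsGeodesicAt.comp_add_const {z : ℝ → E × E} {s c : ℝ} (h : IsGeodesicAt W T z (s + c)) :
    IsGeodesicAt W T (fun t => z (t + c)) s where
  mem := h.mem
  contDiffAt := ContDiffAt.comp s h.contDiffAt (contDiffAt_id.add contDiffAt_const)
  deriv_fst := by rw [deriv_comp_add_const]; exact h.deriv_fst
  orthogonal := by rw [deriv_comp_add_const]; exact h.orthogonal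

variable [FiniteDimensional ℝ F]

/-- In a local chart, a geodesic is an integral curve of the geodesic vector field. -/
lemma LocalChart.hasDerivAt_tangentLift_coord (hc : LocalChart W T φ ψ U V) {z : ℝ → E × E} {s : ℝ}
    (hz : ∀ᶠ t in 𝓝 s, IsGeodesicAt W T z t) (hV : (z s).1 ∈ V) :
    HasDerivAt (fun t => tangentLift ψ (z t)) (geodesicField φ (tangentLift ψ (z s))) s := by
  have hs := hz.self_of_nhds
  obtain ⟨hU, hx⟩ := hc.right_inv (z s).1 ⟨hs.mem.1, hV⟩
  have hψ : DifferentiableAt ℝ (tangentLift ψ) (z s) :=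
    (contDiffAt_tangentLift (hc.contDiffAt_coord hV)).differentiableAt (by norm_num)
  have hcz : ContinuousAt z s := hs.contDiffAt.continuousAt
  -- the coordinates `y` are differentiable, and their derivative is computed from `z = Tφ(y)`
  set y : ℝ → F × F := fun t => tangentLift ψ (z t) with hy
  obtain ⟨y', hy'⟩ : ∃ y', HasDerivAt y y' s :=
    ⟨_, hψ.hasFDerivAt.comp_hasDerivAt s hs.hasDerivAt⟩
  have hUy : (y s).1 ∈ U := hU
  have hzy : z =ᶠ[𝓝 s] fun t => tangentLift φ (y t) := by
    filter_upwards [hz, (continuous_fst.continuousAt.comp hcz).eventually_mem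
      (hc.isOpen_target.mem_nhds hV)] with t ht htV
    exact (hc.tangentLift_param_coord ht.mem htV).symm
  have hd := (hasDerivAt_tangentLift (hc.contDiffAt_param hUy) hy').congr_of_eventuallyEq hzy
  have hinj := hc.injective_fderiv_param hUy
  have heq := hs.hasDerivAt.unique hd
  have hzs : z s = tangentLift φ (y s) := hzy.self_of_nhds
  have h1 : y'.1 = (y s).2 := by
    apply hinj
    have : (z s).2 = fderiv ℝ φ (y s).1 (y s).2 := by rw [hzs]; rfl
    rw [← this, ← hs.deriv_fst, heq]
  have h2 : y'.2 = (geodesicField φ ((y s).1, (y s).2)).2 := by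
    rw [← forall_inner_eq_zero_iff_geodesicField hinj]
    intro η
    have h3 := hs.orthogonal (fderiv ℝ φ (y s).1 η) (by
      have : (z s).1 = φ (y s).1 := by rw [hzs]; rfl
      rw [this, hc.tangent _ hUy]
      exact mem_range_self _)
    rw [heq, h1] at h3
    exact h3
  have h4 : y' = geodesicField φ (y s) := Prod.ext h1 h2
  rw [← h4]
  exact hy'

/-- Integral curves of the geodesic vector field of a local chart are geodesics. -/
lemma LocalChart.isGeodesicAt_tangentLift (hc : LocalChart W T φ ψ U V) {y : ℝ → F × F} {s : ℝ}
    (hy : ∀ᶠ t in 𝓝 s, HasDerivAt y (geodesicField φ (y t)) t) (hU : (y s).1 ∈ U) :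
    IsGeodesicAt W T (fun t => tangentLift φ (y t)) s := by
  have hinj := hc.injective_fderiv_param hU
  have hφ := hc.contDiffAt_param hU
  have hys := hy.self_of_nhds
  have hX : ContDiffAt ℝ 1 (geodesicField φ) (y s) := contDiffAt_geodesicField hφ hinj
  have hy1 : ContDiffAt ℝ 1 y s := by
    rw [contDiffAt_one_iff]
    have hev : ∀ᶠ t in 𝓝 s, HasDerivAt y (geodesicField φ (y t)) t ∧
        ContinuousAt (geodesicField φ) (y t) := by
      refine hy.and (hys.continuousAt.eventually ?_)
      filter_upwards [hX.eventually (by simp)] with t ht using ht.continuousAt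
    refine ⟨fun t => ContinuousLinearMap.toSpanSingleton ℝ (geodesicField φ (y t)),
      {t | HasDerivAt y (geodesicField φ (y t)) t ∧ ContinuousAt (geodesicField φ) (y t)},
      hev, ?_, fun t ht => ht.1.hasFDerivAt⟩
    intro t ht
    refine ContinuousAt.continuousWithinAt ?_
    exact ContinuousAt.comp
      (ContinuousLinearMap.toSpanSingletonCLE (𝕜 := ℝ) (E := F × F)).continuous.continuousAt
      (ht.2.comp ht.1.continuousAt)
  have hd := hasDerivAt_tangentLift hφ hys
  refine ⟨hc.tangentLift_param_mem hU, ?_, ?_, ?_⟩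
  · exact ((contDiffAt_tangentLift hφ).of_le (by norm_num)).comp s hy1
  · rw [hd.deriv]
    rfl
  · intro w hw
    rw [hd.deriv]
    have hw' : w ∈ T (φ (y s).1) := hw
    rw [hc.tangent _ hU] at hw'
    obtain ⟨η, rfl⟩ := hw'
    exact (forall_inner_eq_zero_iff_geodesicField hinj (y s).2 _).2 rfl η

/-- Geodesics with a common phase point coincide near it. -/
lemma HasLocalCharts.eventuallyEq_of_isGeodesicAt (hW : HasLocalCharts F W T) {z w : ℝ → E × E}
    {s : ℝ} (hz : ∀ᶠ t in 𝓝 s, IsGeodesicAt W T z t) (hw : ∀ᶠ t in 𝓝 s, IsGeodesicAt W T w t)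
    (heq : z s = w s) : z =ᶠ[𝓝 s] w := by
  obtain ⟨φ, ψ, U, V, hV, hc⟩ := hW (z s).1 hz.self_of_nhds.mem.1
  obtain ⟨hU, hx⟩ := hc.right_inv (z s).1 ⟨hz.self_of_nhds.mem.1, hV⟩
  have hX : ContDiffAt ℝ 1 (geodesicField φ) (tangentLift ψ (z s)) :=
    contDiffAt_geodesicField (hc.contDiffAt_param hU) (hc.injective_fderiv_param hU)
  obtain ⟨K, S, hS, hK⟩ := hX.exists_lipschitzOnWith
  have key : ∀ z : ℝ → E × E, (∀ᶠ t in 𝓝 s, IsGeodesicAt W T z t) → (z s).1 ∈ V →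
      S ∈ 𝓝 (tangentLift ψ (z s)) → ∀ᶠ t in 𝓝 s, (z t).1 ∈ V ∧
        HasDerivAt (fun t => tangentLift ψ (z t)) (geodesicField φ (tangentLift ψ (z t))) t ∧
        tangentLift ψ (z t) ∈ S := by
    intro z hz hV hS
    have hcz : ContinuousAt z s := hz.self_of_nhds.contDiffAt.continuousAt
    have hψ : ContinuousAt (tangentLift ψ) (z s) :=
      (contDiffAt_tangentLift (hc.contDiffAt_coord hV)).continuousAt
    filter_upwards [hz.eventually_nhds, (continuous_fst.continuousAt.comp hcz).eventually_mem
      (hc.isOpen_target.mem_nhds hV), (ContinuousAt.comp hψ hcz).eventually_mem hS]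
      with t ht htV htS
    exact ⟨htV, hc.hasDerivAt_tangentLift_coord ht htV, htS⟩
  have h1 := key z hz hV hS
  have h2 := key w hw (heq ▸ hV) (heq ▸ hS)
  have h3 := ODE_solution_unique_of_eventually (v := fun _ => geodesicField φ) (s := fun _ => S)
    (Eventually.of_forall fun _ => hK) (h1.mono fun _ h => h.2) (h2.mono fun _ h => h.2)
    (by rw [heq])
  filter_upwards [h1, h2, h3, hz, hw] with t ht1 ht2 ht3 htz htw
  rw [← hc.tangentLift_param_coord htz.mem ht1.1, ← hc.tangentLift_param_coord htw.mem ht2.1, ht3]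

/-- Geodesics on an open interval with a common phase point coincide. -/
lemma HasLocalCharts.eqOn_of_isGeodesicAt (hW : HasLocalCharts F W T) {z w : ℝ → E × E}
    {J : Set ℝ} (hJ : IsOpen J) (hJc : IsPreconnected J) (hz : ∀ s ∈ J, IsGeodesicAt W T z s)
    (hw : ∀ s ∈ J, IsGeodesicAt W T w s) {s₀ : ℝ} (hs₀ : s₀ ∈ J) (heq : z s₀ = w s₀) :
    EqOn z w J := by
  have hzw : ∀ s ∈ J, z s = w s → z =ᶠ[𝓝 s] w := fun s hs h =>
    hW.eventuallyEq_of_isGeodesicAt (by filter_upwards [hJ.mem_nhds hs] using hz)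
      (by filter_upwards [hJ.mem_nhds hs] using hw) h
  have hsub : J ⊆ {s | z =ᶠ[𝓝 s] w} := by
    refine hJc.subset_of_closure_inter_subset isOpen_setOfPred_eventually_nhds
      ⟨s₀, hs₀, hzw s₀ hs₀ heq⟩ ?_
    rintro s ⟨hs, hsJ⟩
    refine hzw s hsJ ?_
    have : (𝓝[{s | z =ᶠ[𝓝 s] w}] s).NeBot := mem_closure_iff_nhdsWithin_neBot.1 hs
    have h1 : Tendsto z (𝓝[{s | z =ᶠ[𝓝 s] w}] s) (𝓝 (z s)) :=
      (hz s hsJ).contDiffAt.continuousAt.tendsto.mono_left nhdsWithin_le_nhds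
    have h2 : Tendsto w (𝓝[{s | z =ᶠ[𝓝 s] w}] s) (𝓝 (w s)) :=
      (hw s hsJ).contDiffAt.continuousAt.tendsto.mono_left nhdsWithin_le_nhds
    refine tendsto_nhds_unique (h1.congr' ?_) h2
    filter_upwards [self_mem_nhdsWithin] with t ht using ht.self_of_nhds
  exact fun s hs => (hsub hs).self_of_nhds

/-- The local geodesic flow: near each point of the tangent bundle, the geodesic flow is the
restriction of a `C¹` map defined on an open subset of the ambient space. -/
lemma HasLocalCharts.exists_localFlow (hW : HasLocalCharts F W T) {z₀ : E × E}
    (hz₀ : z₀ ∈ tangentBundle W T) :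
    ∃ Θ : (E × E) × ℝ → E × E, ∃ O : Set (E × E), IsOpen O ∧ z₀ ∈ O ∧ ∃ ε > 0,
      (∀ z ∈ O, ∀ s ∈ Ioo (-ε) ε, ContDiffAt ℝ 1 Θ (z, s)) ∧
      ∀ z ∈ O ∩ tangentBundle W T, Θ (z, 0) = z ∧
        ∀ s ∈ Ioo (-ε) ε, IsGeodesicAt W T (fun s => Θ (z, s)) s := by
  obtain ⟨φ, ψ, U, V, hV, hc⟩ := hW z₀.1 hz₀.1
  obtain ⟨hU, hx⟩ := hc.right_inv z₀.1 ⟨hz₀.1, hV⟩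
  have hφ := hc.contDiffAt_param hU
  have hX : ContDiffAt ℝ 1 (geodesicField φ) (tangentLift ψ z₀) :=
    contDiffAt_geodesicField hφ (hc.injective_fderiv_param hU)
  obtain ⟨Φ, hΦ1, r, hr, ε, hε, hΦ⟩ := exists_contDiffAt_localFlow hX
  have hΦ0 : Φ (tangentLift ψ z₀, 0) = tangentLift ψ z₀ := (hΦ _ (mem_ball_self hr)).1
  have hψ1 : ContDiffAt ℝ 1 (tangentLift ψ) z₀ :=
    (contDiffAt_tangentLift (hc.contDiffAt_coord hV)).of_le (by norm_num)
  have hψ2 : ContDiffAt ℝ 1 (fun q : (E × E) × ℝ => (tangentLift ψ q.1, q.2)) (z₀, 0) :=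
    (ContDiffAt.comp (z₀, (0 : ℝ)) hψ1 contDiffAt_fst).prodMk contDiffAt_snd
  have hΦψ : ContDiffAt ℝ 1 (fun q : (E × E) × ℝ => Φ (tangentLift ψ q.1, q.2)) (z₀, 0) :=
    ContDiffAt.comp (z₀, (0 : ℝ)) hΦ1 hψ2
  have hΘ : ContDiffAt ℝ 1
      (fun q : (E × E) × ℝ => tangentLift φ (Φ (tangentLift ψ q.1, q.2))) (z₀, 0) := by
    refine ContDiffAt.comp (g := tangentLift φ) (z₀, (0 : ℝ)) ?_ hΦψ
    rw [hΦ0]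
    exact (contDiffAt_tangentLift (y := tangentLift ψ z₀) hφ).of_le (by norm_num)
  -- shrink the domain so that the flow exists and stays in the chart
  have hev : ∀ᶠ q in 𝓝 (z₀, (0 : ℝ)), ContDiffAt ℝ 1
      (fun q : (E × E) × ℝ => tangentLift φ (Φ (tangentLift ψ q.1, q.2))) q ∧ q.1.1 ∈ V ∧
      tangentLift ψ q.1 ∈ ball (tangentLift ψ z₀) r ∧ q.2 ∈ Ioo (-ε) ε ∧
      (Φ (tangentLift ψ q.1, q.2)).1 ∈ U := by
    refine (hΘ.eventually (by simp)).and
      (Eventually.and ?_ (Eventually.and ?_ (Eventually.and ?_ ?_)))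
    · exact (continuous_fst.comp continuous_fst).continuousAt.eventually_mem
        (hc.isOpen_target.mem_nhds hV)
    · exact (ContinuousAt.comp (x := (z₀, (0 : ℝ))) hψ1.continuousAt
        continuous_fst.continuousAt).eventually_mem (ball_mem_nhds _ hr)
    · exact continuous_snd.continuousAt.eventually_mem (Ioo_mem_nhds (by linarith) hε)
    · refine (ContinuousAt.comp (x := (z₀, (0 : ℝ))) continuous_fst.continuousAt
        hΦψ.continuousAt).eventually_mem (hc.isOpen_source.mem_nhds ?_)
      change (Φ (tangentLift ψ z₀, 0)).1 ∈ U
      rw [hΦ0]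
      exact hU
  obtain ⟨δ, hδ, hball⟩ := Metric.eventually_nhds_iff_ball.1 hev
  have hq : ∀ z ∈ ball z₀ δ, ∀ s ∈ Ioo (-δ) δ, (z, s) ∈ ball (z₀, (0 : ℝ)) δ := by
    intro z hz s hs
    rw [← ball_prod_same]
    refine ⟨hz, ?_⟩
    rw [mem_ball_zero_iff, Real.norm_eq_abs]
    exact abs_lt.2 hs
  refine ⟨fun q => tangentLift φ (Φ (tangentLift ψ q.1, q.2)), ball z₀ δ, isOpen_ball,
    mem_ball_self hδ, δ, hδ, fun z hz s hs => (hball _ (hq z hz s hs)).1, ?_⟩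
  rintro z ⟨hz, hzT⟩
  obtain ⟨-, hzV, hzr, -, -⟩ := hball _ (hq z hz 0 ⟨by linarith, hδ⟩)
  refine ⟨?_, fun s hs => ?_⟩
  · change tangentLift φ (Φ (tangentLift ψ z, 0)) = z
    rw [(hΦ _ hzr).1]
    exact hc.tangentLift_param_coord hzT hzV
  · refine hc.isGeodesicAt_tangentLift (y := fun s => Φ (tangentLift ψ z, s)) ?_
      (hball _ (hq z hz s hs)).2.2.2.2
    filter_upwards [isOpen_Ioo.mem_nhds (hball _ (hq z hz s hs)).2.2.2.1] with t ht
    exact (hΦ _ hzr).2 t ht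

/-- Geodesics on overlapping open intervals that share a phase point can be glued. -/
lemma HasLocalCharts.exists_glue (hW : HasLocalCharts F W T) {z w : ℝ → E × E} {a b c d t : ℝ}
    (hz : ∀ s ∈ Ioo a b, IsGeodesicAt W T z s) (hw : ∀ s ∈ Ioo c d, IsGeodesicAt W T w s)
    (ht : t ∈ Ioo a b) (ht' : t ∈ Ioo c d) (heq : z t = w t) :
    ∃ u : ℝ → E × E, EqOn u z (Ioo a b) ∧ ∀ s ∈ Ioo a b ∪ Ioo c d, IsGeodesicAt W T u s := by
  classical
  have hov : EqOn z w (Ioo a b ∩ Ioo c d) := by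
    refine hW.eqOn_of_isGeodesicAt (isOpen_Ioo.inter isOpen_Ioo) ?_
      (fun s hs => hz s hs.1) (fun s hs => hw s hs.2) ⟨ht, ht'⟩ heq
    exact (ordConnected_Ioo.inter ordConnected_Ioo).isPreconnected
  let u : ℝ → E × E := fun s => if s ∈ Ioo a b then z s else w s
  have huz : EqOn u z (Ioo a b) := fun s hs => if_pos hs
  have huw : EqOn u w (Ioo c d) := fun s hs => by
    by_cases h : s ∈ Ioo a b
    · rw [huz h, hov ⟨h, hs⟩]
    · exact if_neg h
  refine ⟨u, huz, ?_⟩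
  rintro s (hs | hs)
  · exact (hz s hs).congr (huz.eventuallyEq_of_mem (isOpen_Ioo.mem_nhds hs))
  · exact (hw s hs).congr (huw.eventuallyEq_of_mem (isOpen_Ioo.mem_nhds hs))

/-- Geodesics starting in a compact part of the tangent bundle exist for a uniform time. -/
lemma HasLocalCharts.exists_uniform_time (hW : HasLocalCharts F W T) {S : Set (E × E)}
    (hS : IsCompact S) (hST : S ⊆ tangentBundle W T) :
    ∃ ε > 0, ∀ z₀ ∈ S, ∃ z : ℝ → E × E, z 0 = z₀ ∧ ∀ s ∈ Ioo (-ε) ε, IsGeodesicAt W T z s := by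
  refine hS.induction_on (p := fun S => ∃ ε > (0 : ℝ), ∀ z₀ ∈ S, ∃ z : ℝ → E × E, z 0 = z₀ ∧
    ∀ s ∈ Ioo (-ε) ε, IsGeodesicAt W T z s) ⟨1, one_pos, by simp⟩ ?_ ?_ ?_
  · rintro A B hAB ⟨ε, hε, h⟩
    exact ⟨ε, hε, fun z hz => h z (hAB hz)⟩
  · rintro A B ⟨ε, hε, h⟩ ⟨ε', hε', h'⟩
    refine ⟨min ε ε', lt_min hε hε', ?_⟩
    rintro z₀ (hz | hz)
    · obtain ⟨z, hz0, hz⟩ := h z₀ hz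
      exact ⟨z, hz0, fun s hs => hz s ⟨by linarith [hs.1, min_le_left ε ε'],
        hs.2.trans_le (min_le_left _ _)⟩⟩
    · obtain ⟨z, hz0, hz⟩ := h' z₀ hz
      exact ⟨z, hz0, fun s hs => hz s ⟨by linarith [hs.1, min_le_right ε ε'],
        hs.2.trans_le (min_le_right _ _)⟩⟩
  · intro z₀ hz₀
    obtain ⟨Θ, O, hO, hzO, ε, hε, -, hΘ⟩ := hW.exists_localFlow (hST hz₀)
    refine ⟨O ∩ S, inter_mem (mem_nhdsWithin_of_mem_nhds (hO.mem_nhds hzO)) self_mem_nhdsWithin,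
      ε, hε, fun z hz => ⟨fun s => Θ (z, s), hΘ z ⟨hz.1, hST hz.2⟩⟩⟩

/-- A geodesic exists on `(-R, R)` if, as long as it exists, it stays in a fixed compact part of
the tangent bundle. -/
lemma HasLocalCharts.exists_isGeodesicAt_Ioo (hW : HasLocalCharts F W T) {S : Set (E × E)}
    (hS : IsCompact S) (hST : S ⊆ tangentBundle W T) {z₀ : E × E} {R : ℝ} (hR : 0 ≤ R)
    (htrap : ∀ (z : ℝ → E × E) (r : ℝ), z 0 = z₀ → (∀ s ∈ Ioo (-r) r, IsGeodesicAt W T z s) →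
      ∀ s ∈ Ioo (-r) r, |s| ≤ R → z s ∈ S) (hz₀ : z₀ ∈ S) :
    ∃ z : ℝ → E × E, z 0 = z₀ ∧ ∀ s ∈ Ioo (-R) R, IsGeodesicAt W T z s := by
  obtain ⟨ε, hε, hex⟩ := hW.exists_uniform_time hS hST
  -- the interval of existence grows by `ε / 2` as long as it is contained in `(-R - ε, R + ε)`
  have key : ∀ k : ℕ, k * (ε / 2) ≤ R → ∃ z : ℝ → E × E, z 0 = z₀ ∧
      ∀ s ∈ Ioo (-(k * (ε / 2) + ε)) (k * (ε / 2) + ε), IsGeodesicAt W T z s := by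
    intro k
    induction k with
    | zero =>
      intro _
      obtain ⟨z, h0, hz⟩ := hex z₀ hz₀
      exact ⟨z, h0, by simpa using hz⟩
    | succ k ih =>
      intro hk
      push_cast at hk ⊢
      have hk0 : 0 ≤ (k : ℝ) * (ε / 2) := by positivity
      obtain ⟨z, h0, hz⟩ := ih (by linarith)
      set r := (k : ℝ) * (ε / 2) + ε with hr
      set t := ((k : ℝ) + 1) * (ε / 2) with ht
      have htr : t = r - ε / 2 := by rw [ht, hr]; ring
      have ht0 : 0 ≤ t := by rw [htr, hr]; linarith
      have h1 : t ∈ Ioo (-r) r := ⟨by linarith, by linarith⟩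
      have h2 : -t ∈ Ioo (-r) r := ⟨by linarith, by linarith⟩
      obtain ⟨w, hw0, hw⟩ := hex (z t) (htrap z r h0 hz t h1 (by rwa [abs_of_nonneg ht0]))
      obtain ⟨v, hv0, hv⟩ := hex (z (-t))
        (htrap z r h0 hz (-t) h2 (by rwa [abs_neg, abs_of_nonneg ht0]))
      obtain ⟨p, hpz, hp⟩ := hW.exists_glue (w := fun s => w (s + -t)) (c := t - ε) (d := t + ε) hz
        (fun s hs => (hw (s + -t) ⟨by linarith [hs.1], by linarith [hs.2]⟩).comp_add_const) h1
        ⟨by linarith, by linarith⟩ (by simp [hw0])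
      obtain ⟨q, hqp, hq⟩ := hW.exists_glue (z := p) (a := -r) (b := t + ε)
        (w := fun s => v (s + t)) (c := -t - ε) (d := -t + ε) (t := -t)
        (fun s hs => hp s (by
          rcases lt_or_ge s r with h | h
          · exact Or.inl ⟨hs.1, h⟩
          · exact Or.inr ⟨by linarith, hs.2⟩))
        (fun s hs => (hv (s + t) ⟨by linarith [hs.1], by linarith [hs.2]⟩).comp_add_const)
        ⟨by linarith, by linarith⟩ ⟨by linarith, by linarith⟩ (by simp [hv0, hpz h2])
      refine ⟨q, ?_, fun s hs => hq s ?_⟩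
      · rw [hqp ⟨by linarith, by linarith⟩, hpz ⟨by linarith, by linarith⟩, h0]
      · rcases lt_or_ge (-r) s with h | h
        · exact Or.inl ⟨h, hs.2⟩
        · exact Or.inr ⟨by linarith [hs.1], by linarith⟩
  have hfl : (⌊R / (ε / 2)⌋₊ : ℝ) * (ε / 2) ≤ R := by
    rw [← le_div_iff₀ (by positivity)]
    exact Nat.floor_le (by positivity)
  have hfl' : R < (⌊R / (ε / 2)⌋₊ : ℝ) * (ε / 2) + ε / 2 := by
    have := Nat.lt_floor_add_one (R / (ε / 2))
    rw [div_lt_iff₀ (by positivity)] at this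
    linarith
  obtain ⟨z, h0, hz⟩ := key _ hfl
  exact ⟨z, h0, fun s hs => hz s ⟨by linarith [hs.1], by linarith [hs.2]⟩⟩

/-- A complete geodesic exists if, on every bounded time interval, the geodesic stays in a compact
part of the tangent bundle as long as it exists. -/
lemma HasLocalCharts.exists_isGeodesicAt (hW : HasLocalCharts F W T) {z₀ : E × E}
    (htrap : ∀ R : ℝ, 0 ≤ R → ∃ S : Set (E × E), IsCompact S ∧ S ⊆ tangentBundle W T ∧ z₀ ∈ S ∧
      ∀ (z : ℝ → E × E) (r : ℝ), z 0 = z₀ → (∀ s ∈ Ioo (-r) r, IsGeodesicAt W T z s) →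
        ∀ s ∈ Ioo (-r) r, |s| ≤ R → z s ∈ S) :
    ∃ z : ℝ → E × E, z 0 = z₀ ∧ ∀ s, IsGeodesicAt W T z s := by
  have hex : ∀ k : ℕ, ∃ z : ℝ → E × E, z 0 = z₀ ∧
      ∀ s ∈ Ioo (-(k + 1 : ℝ)) (k + 1), IsGeodesicAt W T z s := fun k => by
    obtain ⟨S, hS, hST, hz₀, h⟩ := htrap (k + 1) (by positivity)
    exact hW.exists_isGeodesicAt_Ioo hS hST (by positivity) h hz₀
  choose z h0 hz using hex
  have hmono : ∀ {k l : ℕ}, k ≤ l → EqOn (z k) (z l) (Ioo (-(k + 1 : ℝ)) (k + 1)) := by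
    intro k l hkl
    have hkl' : (k : ℝ) ≤ l := by exact_mod_cast hkl
    have hk : (0 : ℝ) ≤ k := by positivity
    refine hW.eqOn_of_isGeodesicAt isOpen_Ioo isPreconnected_Ioo (hz k)
      (fun s hs => hz l s ⟨by linarith [hs.1], by linarith [hs.2]⟩)
      (s₀ := 0) ⟨by linarith, by linarith⟩ (by rw [h0, h0])
  have hmem : ∀ s : ℝ, s ∈ Ioo (-(⌊|s|⌋₊ + 1 : ℝ)) (⌊|s|⌋₊ + 1) := fun s =>
    abs_lt.1 (Nat.lt_floor_add_one _)
  refine ⟨fun s => z ⌊|s|⌋₊ s, by simp [h0], fun s => ?_⟩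
  refine (hz ⌊|s|⌋₊ s (hmem s)).congr ?_
  filter_upwards [isOpen_Ioo.mem_nhds (hmem s)] with t ht
  rcases le_total ⌊|s|⌋₊ ⌊|t|⌋₊ with h | h
  · exact (hmono h ht).symm
  · exact hmono h (hmem t)

end GeodesicCurves

/-! ### Charts from immersions -/

section ChartConstruction

variable {E F : Type*} [NormedAddCommGroup E] [NormedSpace ℝ E]
  [FiniteDimensional ℝ E] [NormedAddCommGroup F] [NormedSpace ℝ F] [FiniteDimensional ℝ F]

/-- A `C³` immersion has a local left inverse of class `C³` on the ambient space: compose it with a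
linear left inverse of its derivative, and apply the inverse function theorem. -/
lemma exists_contDiffAt_leftInverse {φ : F → E} {u₀ : F} (hφ : ContDiffAt ℝ 3 φ u₀)
    (hinj : Function.Injective (fderiv ℝ φ u₀)) :
    ∃ ψ : E → F, ContDiffAt ℝ 3 ψ (φ u₀) ∧ ∀ᶠ u in 𝓝 u₀, ψ (φ u) = u := by
  have : CompleteSpace F := FiniteDimensional.complete ℝ F
  obtain ⟨A, hA⟩ := (fderiv ℝ φ u₀).toLinearMap.exists_leftInverse_of_injective
    (LinearMap.ker_eq_bot.2 hinj)
  let A' : E →L[ℝ] F := LinearMap.toContinuousLinearMap A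
  have hAφ : ContDiffAt ℝ 3 (A' ∘ φ) u₀ := A'.contDiff.contDiffAt.comp u₀ hφ
  have hd : HasFDerivAt (A' ∘ φ) ((ContinuousLinearEquiv.refl ℝ F : F ≃L[ℝ] F) : F →L[ℝ] F) u₀ := by
    have h1 := A'.hasFDerivAt.comp u₀ (hφ.differentiableAt (by norm_num)).hasFDerivAt
    have h2 : A' ∘L fderiv ℝ φ u₀ = ((ContinuousLinearEquiv.refl ℝ F : F ≃L[ℝ] F) : F →L[ℝ] F) := by
      ext ξ
      exact congrArg (fun l : F →ₗ[ℝ] F => l ξ) hA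
    rwa [h2] at h1
  refine ⟨hAφ.localInverse hd (by norm_num) ∘ A', ?_, ?_⟩
  · exact ContDiffAt.comp (φ u₀) (hAφ.to_localInverse hd (by norm_num)) A'.contDiff.contDiffAt
  · exact (hAφ.hasStrictFDerivAt' hd (by norm_num)).eventually_left_inverse

end ChartConstruction

section ChartOfImmersion

variable {E F : Type*} [NormedAddCommGroup E] [InnerProductSpace ℝ E]
  [FiniteDimensional ℝ E] [NormedAddCommGroup F] [NormedSpace ℝ F] [FiniteDimensional ℝ F]

/-- A parametrization by an immersion that is open onto its image gives a local chart. -/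
lemma exists_localChart {W : Set E} {T : E → Set E} {φ : F → E} {D : Set F} (hD : IsOpen D)
    {u₀ : F} (hu₀ : u₀ ∈ D) (hφ : ContDiffOn ℝ 3 φ D) (hmem : ∀ u ∈ D, φ u ∈ W)
    (hT : ∀ u ∈ D, T (φ u) = range (fderiv ℝ φ u)) (hinj : Function.Injective (fderiv ℝ φ u₀))
    (hopen : ∀ N ∈ 𝓝 u₀, ∀ᶠ w in 𝓝 (φ u₀), w ∈ W → w ∈ φ '' N) :
    ∃ (ψ : E → F) (U : Set F) (V : Set E), φ u₀ ∈ V ∧ LocalChart W T φ ψ U V := by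
  have hφ₀ : ContDiffAt ℝ 3 φ u₀ := hφ.contDiffAt (hD.mem_nhds hu₀)
  obtain ⟨ψ, hψ, hleft⟩ := exists_contDiffAt_leftInverse hφ₀ hinj
  obtain ⟨V₀, hV₀, hV₀o, hmV₀⟩ := _root_.eventually_nhds_iff.1 (hψ.eventually (by simp))
  obtain ⟨N, hN, hNo, hmN⟩ := _root_.eventually_nhds_iff.1 (hleft.and (hD.mem_nhds hu₀))
  obtain ⟨V₁, hV₁, hV₁o, hmV₁⟩ := _root_.eventually_nhds_iff.1 (hopen N (hNo.mem_nhds hmN))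
  have hND : N ⊆ D := fun u hu => (hN u hu).2
  refine ⟨ψ, N ∩ φ ⁻¹' (V₀ ∩ V₁), V₀ ∩ V₁, ⟨hmV₀, hmV₁⟩, ?_⟩
  refine
    { isOpen_source := (hφ.continuousOn.mono hND).isOpen_inter_preimage hNo (hV₀o.inter hV₁o)
      isOpen_target := hV₀o.inter hV₁o
      contDiffOn_param := hφ.mono (inter_subset_left.trans hND)
      contDiffOn_coord := fun x hx => (hV₀ x hx.1).contDiffWithinAt
      mapsTo := fun u hu => ⟨hmem u (hND hu.1), hu.2⟩
      left_inv := fun u hu => (hN u hu.1).1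
      right_inv := ?_
      tangent := fun u hu => hT u (hND hu.1) }
  rintro w ⟨hwW, hwV⟩
  obtain ⟨u, hu, rfl⟩ := hV₁ w hwV.2 hwW
  have h1 : ψ (φ u) = u := (hN u hu).1
  rw [h1]
  exact ⟨⟨hu, hwV⟩, rfl⟩

end ChartOfImmersion

/-! ### The punctured cone as a submanifold -/

section Cone

variable {n N : ℕ} {M : Type*} [TopologicalSpace M]
  [ChartedSpace (EuclideanSpace ℝ (Fin n)) M] [IsManifold (𝓡 n) 3 M]
  {g : Bundle.ContMDiffRiemannianMetric (𝓡 n) 2 (EuclideanSpace ℝ (Fin n))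
    (fun p : M => TangentSpace (𝓡 n) p)}
  {f : M → Amb N}

namespace IsIsometricEmbeddingInPlane

lemma smul_apply_last (hf : IsIsometricEmbeddingInPlane g f) (t : ℝ) (p : M) :
    (t • f p) (Fin.last N) = t := by
  simp [hf.last_eq_one p]

lemma smul_ne_zero (hf : IsIsometricEmbeddingInPlane g f) {t : ℝ} (ht : t ≠ 0) (p : M) :
    t • f p ≠ 0 := fun h => ht (by simpa [h] using (hf.smul_apply_last t p).symm)

lemma smul_eq_smul (hf : IsIsometricEmbeddingInPlane g f) {t t' : ℝ} (ht : t ≠ 0) {p p' : M}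
    (h : t • f p = t' • f p') : t = t' ∧ p = p' := by
  have h1 : t = t' := by rw [← hf.smul_apply_last t p, h, hf.smul_apply_last]
  subst h1
  exact ⟨rfl, hf.injective (smul_right_injective _ ht h)⟩

lemma tangentCone_smul (hf : IsIsometricEmbeddingInPlane g f) {t : ℝ} (ht : t ≠ 0) (p : M) :
    tangentCone n f (t • f p) = (Submodule.span ℝ {f p} ⊔ tangentImage n f p : Submodule ℝ _) := by
  ext w
  constructor
  · rintro (⟨h, -⟩ | ⟨t', p', ht', h, hw⟩)
    · exact absurd h (hf.smul_ne_zero ht p)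
    · obtain ⟨-, rfl⟩ := hf.smul_eq_smul ht h
      exact hw
  · exact fun hw => Or.inr ⟨t, p, ht, rfl, hw⟩

lemma tangentCone_zero (hf : IsIsometricEmbeddingInPlane g f) : tangentCone n f 0 = cone f := by
  ext w
  constructor
  · rintro (⟨-, h⟩ | ⟨t, p, ht, h, -⟩)
    · exact h
    · exact absurd h.symm (hf.smul_ne_zero ht p)
  · exact fun hw => Or.inl ⟨rfl, hw⟩

lemma injective_differential (hf : IsIsometricEmbeddingInPlane g f) (p : M) :
    Function.Injective (differential n f p) := by
  rw [injective_iff_map_eq_zero]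
  intro v hv
  by_contra h
  have h1 := hf.isometric p v v
  rw [hv, inner_zero_left] at h1
  exact (g.pos p v h).ne h1

lemma continuous (hf : IsIsometricEmbeddingInPlane g f) : Continuous f := hf.contMDiff.continuous

lemma isClosed_cone [CompactSpace M] (hf : IsIsometricEmbeddingInPlane g f) :
    IsClosed (cone f) := by
  have hcl : cone f = Prod.fst '' {q : Amb N × M | q.1 = q.1 (Fin.last N) • f q.2} := by
    ext x
    constructor
    · rintro ⟨t, p, rfl⟩
      exact ⟨(t • f p, p), by simp [hf.last_eq_one], rfl⟩
    · rintro ⟨⟨x, p⟩, h, rfl⟩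
      exact ⟨_, p, h⟩
  rw [hcl]
  refine isClosedMap_fst_of_compactSpace _ (isClosed_eq continuous_fst ?_)
  exact ((EuclideanSpace.proj (Fin.last N) : Amb N →L[ℝ] ℝ).continuous.comp continuous_fst).smul
    (hf.continuous.comp continuous_snd)

/-- The immersion `f` read in the chart at `p₀` is an immersion with the same tangent spaces. -/
lemma exists_fderiv_comp_extChartAt_symm (hf : IsIsometricEmbeddingInPlane g f) (p₀ : M)
    {u : EuclideanSpace ℝ (Fin n)} (hu : u ∈ (extChartAt (𝓡 n) p₀).target) :
    Function.Injective (fderiv ℝ (f ∘ (extChartAt (𝓡 n) p₀).symm) u) ∧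
      range (fderiv ℝ (f ∘ (extChartAt (𝓡 n) p₀).symm) u) =
        tangentImage n f ((extChartAt (𝓡 n) p₀).symm u) := by
  have : IsManifold (𝓡 n) 1 M := IsManifold.of_le (n := 3) (by norm_num)
  obtain ⟨e, he⟩ := isInvertible_mfderivWithin_extChartAt_symm hu
  rw [ModelWithCorners.range_eq_univ, mfderivWithin_univ] at he
  have h1 : MDifferentiableAt (𝓡 n) 𝓘(ℝ, Amb N) f ((extChartAt (𝓡 n) p₀).symm u) :=
    (hf.contMDiff _).mdifferentiableAt (by norm_num)
  have h2 : MDifferentiableAt 𝓘(ℝ, EuclideanSpace ℝ (Fin n)) (𝓡 n) (extChartAt (𝓡 n) p₀).symm u :=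
    ((contMDiffOn_extChartAt_symm (n := 3) p₀).contMDiffAt
      ((isOpen_extChartAt_target p₀).mem_nhds hu)).mdifferentiableAt (by norm_num)
  have h3 := mfderiv_comp u h1 h2
  rw [mfderiv_eq_fderiv, ← he] at h3
  have h4 : ∀ ξ, fderiv ℝ (f ∘ (extChartAt (𝓡 n) p₀).symm) u ξ =
      differential n f ((extChartAt (𝓡 n) p₀).symm u) (e ξ) := fun ξ => by
    rw [h3]
    rfl
  constructor
  · intro ξ η h
    rw [h4, h4] at h
    exact e.injective (hf.injective_differential _ h)
  · ext w
    constructor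
    · rintro ⟨ξ, rfl⟩
      exact ⟨e ξ, (h4 ξ).symm⟩
    · rintro ⟨v, rfl⟩
      exact ⟨e.symm v, (h4 _).trans (congrArg (differential n f _) (e.apply_symm_apply v))⟩

/-- The cone without its vertex is a submanifold of class `C³`. -/
theorem hasLocalCharts_cone [T2Space M] [CompactSpace M]
    (hf : IsIsometricEmbeddingInPlane g f) :
    HasLocalCharts (ℝ × EuclideanSpace ℝ (Fin n)) (cone f \ {0}) (tangentCone n f) := by
  rintro _ ⟨⟨t₀, p₀, rfl⟩, hne⟩
  have ht₀ : t₀ ≠ 0 := by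
    rintro rfl
    exact hne (by simp)
  set χ := extChartAt (𝓡 n) p₀ with hχ
  set h : EuclideanSpace ℝ (Fin n) → Amb N := f ∘ χ.symm with hh
  have hχo : IsOpen χ.target := isOpen_extChartAt_target p₀
  have hh3 : ContDiffOn ℝ 3 h χ.target :=
    contMDiffOn_iff_contDiffOn.1 (hf.contMDiff.comp_contMDiffOn (contMDiffOn_extChartAt_symm p₀))
  have hhlast : ∀ u, h u (Fin.last N) = 1 := fun u => hf.last_eq_one _
  let φ : ℝ × EuclideanSpace ℝ (Fin n) → Amb N := fun q => q.1 • h q.2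
  let D : Set (ℝ × EuclideanSpace ℝ (Fin n)) := {t | t ≠ 0} ×ˢ χ.target
  have hD : IsOpen D := isOpen_ne.prod hχo
  have hφ : ContDiffOn ℝ 3 φ D :=
    contDiffOn_fst.smul (hh3.comp contDiffOn_snd fun q hq => hq.2)
  have hderiv : ∀ q ∈ D, ∀ τ ξ, fderiv ℝ φ q (τ, ξ) = τ • h q.2 + q.1 • fderiv ℝ h q.2 ξ := by
    intro q hq τ ξ
    have h1 : HasFDerivAt (fun q : ℝ × EuclideanSpace ℝ (Fin n) => h q.2)
        (fderiv ℝ h q.2 ∘L ContinuousLinearMap.snd ℝ _ _) q :=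
      HasFDerivAt.comp q ((hh3.contDiffAt (hχo.mem_nhds hq.2)).differentiableAt
        (by norm_num)).hasFDerivAt hasFDerivAt_snd
    have h2 := (hasFDerivAt_fst (𝕜 := ℝ) (p := q)).smul h1
    have h3 : fderiv ℝ φ q = _ := h2.fderiv
    rw [h3]
    simp [add_comm]
  have hDlast : ∀ u ∈ χ.target, ∀ ξ, fderiv ℝ h u ξ (Fin.last N) = 0 := by
    intro u hu ξ
    have h1 := ((hh3.contDiffAt (hχo.mem_nhds hu)).differentiableAt
      (by norm_num)).hasFDerivAt
    have h2 := ((EuclideanSpace.proj (Fin.last N) : Amb N →L[ℝ] ℝ).hasFDerivAt (x := h u)).comp u h1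
    have h3 : HasFDerivAt (⇑(EuclideanSpace.proj (Fin.last N) : Amb N →L[ℝ] ℝ) ∘ h)
        (0 : EuclideanSpace ℝ (Fin n) →L[ℝ] ℝ) u := by
      have : (⇑(EuclideanSpace.proj (Fin.last N) : Amb N →L[ℝ] ℝ) ∘ h) = fun _ => 1 :=
        funext hhlast
      rw [this]
      exact hasFDerivAt_const _ _
    exact congrArg (fun l : EuclideanSpace ℝ (Fin n) →L[ℝ] ℝ => l ξ) (h2.unique h3)
  have hu₀ : χ p₀ ∈ χ.target := mem_extChartAt_target p₀
  have hx₀ : h (χ p₀) = f p₀ := by simp [hh, hχ]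
  have hφ₀ : φ (t₀, χ p₀) = t₀ • f p₀ := by simp only [φ, hx₀]
  have hchart := exists_localChart (W := cone f \ {0}) (T := tangentCone n f) (φ := φ) hD
    (u₀ := (t₀, χ p₀)) ⟨ht₀, hu₀⟩ hφ ?_ ?_ ?_ ?_
  · obtain ⟨ψ, U, V, hV, hc⟩ := hchart
    exact ⟨φ, ψ, U, V, hφ₀ ▸ hV, hc⟩
  · exact fun q hq => ⟨⟨q.1, _, rfl⟩, hf.smul_ne_zero hq.1 _⟩
  · intro q hq
    change tangentCone n f (q.1 • f (χ.symm q.2)) = _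
    rw [hf.tangentCone_smul hq.1]
    have hr := (hf.exists_fderiv_comp_extChartAt_symm p₀ hq.2).2
    ext w
    rw [SetLike.mem_coe, Submodule.mem_sup]
    constructor
    · rintro ⟨a, ha, b, hb, rfl⟩
      obtain ⟨τ, rfl⟩ := Submodule.mem_span_singleton.1 ha
      have hb' : b ∈ range (fderiv ℝ h q.2) := by rw [hr]; exact hb
      obtain ⟨ξ, rfl⟩ := hb'
      refine ⟨(τ, q.1⁻¹ • ξ), ?_⟩
      rw [hderiv q hq, map_smul, smul_inv_smul₀ hq.1]
      rfl
    · rintro ⟨⟨τ, ξ⟩, rfl⟩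
      rw [hderiv q hq]
      refine ⟨_, Submodule.smul_mem _ τ (Submodule.mem_span_singleton_self _), _, ?_, rfl⟩
      have : fderiv ℝ h q.2 ξ ∈ (tangentImage n f (χ.symm q.2) : Set (Amb N)) := by
        rw [← hr]; exact mem_range_self _
      exact Submodule.smul_mem _ _ this
  · rw [injective_iff_map_eq_zero]
    rintro ⟨τ, ξ⟩ h0
    rw [hderiv (t₀, χ p₀) ⟨ht₀, hu₀⟩] at h0
    have hτ : τ = 0 := by
      have := congrArg (fun w : Amb N => w (Fin.last N)) h0
      simpa [hhlast, hDlast _ hu₀] using this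
    subst hτ
    rw [zero_smul, zero_add, smul_eq_zero_iff_right ht₀] at h0
    have := (injective_iff_map_eq_zero _).1
      (hf.exists_fderiv_comp_extChartAt_symm p₀ hu₀).1 ξ h0
    rw [this]
    rfl
  · -- `f` is an embedding, so that `(t, p)` depends continuously on `t • f p`
    intro B hB
    rw [hφ₀]
    have hemb : IsClosedEmbedding f := hf.continuous.isClosedEmbedding hf.injective
    have hχc : ContinuousAt (fun q : ℝ × M => (q.1, χ q.2)) (t₀, p₀) :=
      continuousAt_fst.prodMk (ContinuousAt.comp (x := (t₀, p₀)) (g := χ)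
        (continuousAt_extChartAt p₀) continuousAt_snd)
    have hBt : ∀ᶠ q in 𝓝 (t₀, p₀), (q.1, χ q.2) ∈ B := hχc.eventually_mem hB
    have hsrc : ∀ᶠ q in 𝓝 (t₀, p₀), q.2 ∈ χ.source :=
      continuousAt_snd (extChartAt_source_mem_nhds p₀)
    have hev := hBt.and hsrc
    rw [nhds_prod_eq, hemb.isInducing.nhds_eq_comap, eventually_prod_iff] at hev
    obtain ⟨P, hP, Q, hQ, hPQ⟩ := hev
    rw [eventually_comap] at hQ
    have hlast : ContinuousAt (fun w : Amb N => w (Fin.last N)) (t₀ • f p₀) :=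
      (EuclideanSpace.proj (Fin.last N) : Amb N →L[ℝ] ℝ).continuous.continuousAt
    have hl0 : (t₀ • f p₀) (Fin.last N) = t₀ := hf.smul_apply_last _ _
    have hproj : Tendsto (fun w : Amb N => (w (Fin.last N))⁻¹ • w) (𝓝 (t₀ • f p₀)) (𝓝 (f p₀)) := by
      have h1 := (hlast.inv₀ (by rwa [hl0])).smul (continuousAt_id (x := t₀ • f p₀))
      have h2 : Tendsto (fun w : Amb N => (w (Fin.last N))⁻¹ • w) (𝓝 (t₀ • f p₀))
          (𝓝 (((t₀ • f p₀) (Fin.last N))⁻¹ • (t₀ • f p₀))) := h1.tendsto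
      rwa [hl0, inv_smul_smul₀ ht₀] at h2
    have hlast' := hlast.tendsto
    rw [hl0] at hlast'
    filter_upwards [hlast'.eventually hP, hproj.eventually hQ] with w hw1 hw2 hwW
    obtain ⟨⟨t, p, rfl⟩, hw0⟩ := hwW
    have ht : t ≠ 0 := by
      rintro rfl
      exact hw0 (by simp)
    rw [hf.smul_apply_last] at hw1 hw2
    rw [inv_smul_smul₀ ht] at hw2
    obtain ⟨hb, hs⟩ := hPQ hw1 (hw2 p rfl)
    refine ⟨(t, χ p), hb, ?_⟩
    simp only [φ, hh, Function.comp, χ.left_inv hs]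

end IsIsometricEmbeddingInPlane

end Cone

/-! ### Conservation laws -/

section Conservation

variable {E : Type*} [NormedAddCommGroup E] [InnerProductSpace ℝ E]

lemma eq_of_hasDerivAt_zero {J : Set ℝ} (hJ : IsOpen J) (hJc : IsPreconnected J) {h : ℝ → ℝ}
    (hh : ∀ s ∈ J, HasDerivAt h 0 s) {s t : ℝ} (hs : s ∈ J) (ht : t ∈ J) : h s = h t :=
  hJ.is_const_of_deriv_eq_zero hJc (fun s hs => (hh s hs).differentiableAt.differentiableWithinAt)
    (fun s hs => (hh s hs).deriv) hs ht

/-- A unit-speed curve whose acceleration is orthogonal to its position satisfies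
`⟪x, x'⟫ = s + b` and `‖x‖² - (s + b)² = const`. -/
lemma inner_eq_and_normSq_eq {J : Set ℝ} (hJ : IsOpen J) (hJc : IsPreconnected J) (h0 : 0 ∈ J)
    {x v a : ℝ → E} (hx : ∀ s ∈ J, HasDerivAt x (v s) s) (hv : ∀ s ∈ J, HasDerivAt v (a s) s)
    (hunit : ∀ s ∈ J, ‖v s‖ = 1) (hax : ∀ s ∈ J, ⟪a s, x s⟫ = 0) {s : ℝ} (hs : s ∈ J) :
    ⟪x s, v s⟫ = s + ⟪x 0, v 0⟫ ∧
      ‖x s‖ ^ 2 = (s + ⟪x 0, v 0⟫) ^ 2 + (‖x 0‖ ^ 2 - ⟪x 0, v 0⟫ ^ 2) := by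
  have h1 : ∀ s ∈ J, ⟪x s, v s⟫ = s + ⟪x 0, v 0⟫ := by
    intro s hs
    have hd : ∀ t ∈ J, HasDerivAt (fun t => ⟪x t, v t⟫ - t) 0 t := by
      intro t ht
      have : HasDerivAt (fun t => ⟪x t, v t⟫ - t) _ t :=
        ((hx t ht).inner ℝ (hv t ht)).sub (hasDerivAt_id t)
      rw [real_inner_comm, hax t ht, real_inner_self_eq_norm_sq, hunit t ht] at this
      simpa using this
    have := eq_of_hasDerivAt_zero hJ hJc hd hs h0
    simp only [sub_zero] at this
    linarith
  refine ⟨h1 s hs, ?_⟩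
  have hd : ∀ t ∈ J, HasDerivAt (fun t => ‖x t‖ ^ 2 - (t + ⟪x 0, v 0⟫) ^ 2) 0 t := by
    intro t ht
    have h2 := (hx t ht).norm_sq
    have h3 := ((hasDerivAt_id t).add_const ⟪x 0, v 0⟫).pow 2
    have h4 : HasDerivAt (fun t => ‖x t‖ ^ 2 - (t + ⟪x 0, v 0⟫) ^ 2) _ t := h2.sub h3
    rw [h1 t ht] at h4
    simpa using h4
  have := eq_of_hasDerivAt_zero hJ hJc hd hs h0
  simp only [zero_add] at this
  linarith

lemma norm_eq_of_inner_deriv_eq_zero {J : Set ℝ} (hJ : IsOpen J) (hJc : IsPreconnected J)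
    {v a : ℝ → E} (hv : ∀ s ∈ J, HasDerivAt v (a s) s) (hav : ∀ s ∈ J, ⟪a s, v s⟫ = 0) {s t : ℝ}
    (hs : s ∈ J) (ht : t ∈ J) : ‖v s‖ = ‖v t‖ := by
  have hd : ∀ t ∈ J, HasDerivAt (fun t => ‖v t‖ ^ 2) 0 t := by
    intro t ht
    have := (hv t ht).norm_sq
    rw [real_inner_comm, hav t ht, mul_zero] at this
    exact this
  have := eq_of_hasDerivAt_zero hJ hJc hd hs ht
  exact (pow_left_inj₀ (norm_nonneg _) (norm_nonneg _) two_ne_zero).1 this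

end Conservation

section DistSq

variable {N : ℕ}

lemma distSq_of_norm_eq_one {z : Amb N × Amb N} (hz : ‖z.2‖ = 1) :
    distSq z = ‖z.1‖ ^ 2 - ⟪z.1, z.2⟫ ^ 2 := by
  simp [distSq, hz]

lemma norm_sub_inner_smul_sq {z : Amb N × Amb N} (hz : ‖z.2‖ = 1) :
    ‖z.1 - ⟪z.1, z.2⟫ • z.2‖ ^ 2 = distSq z := by
  rw [distSq_of_norm_eq_one hz, norm_sub_sq_real, real_inner_smul_right, norm_smul, hz,
    Real.norm_eq_abs, mul_one, sq_abs]
  ring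

lemma distSq_nonneg {z : Amb N × Amb N} (hz : ‖z.2‖ = 1) : 0 ≤ distSq z := by
  rw [← norm_sub_inner_smul_sq hz]
  positivity

lemma distSq_eq_zero_iff {z : Amb N × Amb N} (hz : ‖z.2‖ = 1) :
    distSq z = 0 ↔ ∃ k : ℝ, z.1 = k • z.2 := by
  constructor
  · intro h
    rw [← norm_sub_inner_smul_sq hz] at h
    exact ⟨_, sub_eq_zero.1 (norm_eq_zero.1 (pow_eq_zero_iff two_ne_zero |>.1 h))⟩
  · rintro ⟨k, hk⟩
    rw [distSq_of_norm_eq_one hz, hk, norm_smul, real_inner_smul_left, real_inner_self_eq_norm_sq,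
      hz, Real.norm_eq_abs, mul_one, sq_abs]
    ring

lemma contDiffAt_distSq {z : Amb N × Amb N} (hz : ‖z.2‖ = 1) : ContDiffAt ℝ 1 distSq z := by
  have h1 : ContDiffAt ℝ 1 (fun z : Amb N × Amb N => ‖z.1‖ ^ 2) z := contDiffAt_fst.norm_sq ℝ
  have h2 : ContDiffAt ℝ 1 (fun z : Amb N × Amb N => ⟪z.1, z.2⟫) z :=
    contDiffAt_fst.inner ℝ contDiffAt_snd
  have h3 : ContDiffAt ℝ 1 (fun z : Amb N × Amb N => ‖z.2‖ ^ 2) z := contDiffAt_snd.norm_sq ℝ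
  exact h1.sub ((h2.pow 2).div h3 (by rw [hz]; norm_num))

end DistSq

/-! ### Radial geodesics and geodesics through the vertex -/

section Radial

variable {N : ℕ} {M : Type*} {f : M → Amb N}

lemma phase_comp_add_const (γ : ℝ → Amb N) (c s : ℝ) :
    phase (fun s => γ (s + c)) s = phase γ (s + c) := by
  simp only [phase, deriv_comp_add_const]

lemma smul_mem_cone {x : Amb N} (hx : x ∈ cone f) (c : ℝ) : c • x ∈ cone f := by
  obtain ⟨t, p, rfl⟩ := hx
  exact ⟨c * t, p, by rw [mul_smul]⟩

lemma IsRadial.exists_deriv_eq {γ : ℝ → Amb N} (h : IsRadial f γ) :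
    ∃ p ∈ cone f, ‖p‖ = 1 ∧ ∃ c : ℝ, (∀ s, γ s = (s + c) • p) ∧ deriv γ = fun _ => p := by
  obtain ⟨p, hp, hp1, c, hγ⟩ := h
  refine ⟨p, hp, hp1, c, hγ, ?_⟩
  funext s
  have h1 : γ = fun s => (s + c) • p := funext hγ
  rw [h1]
  have h2 := ((hasDerivAt_id s).add_const c).smul_const p
  rw [one_smul] at h2
  exact h2.deriv

lemma IsRadial.distSq_phase {γ : ℝ → Amb N} (h : IsRadial f γ) : distSq (phase γ 0) = 0 := by
  obtain ⟨p, hp, hp1, c, hγ, hd⟩ := h.exists_deriv_eq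
  have h1 : (phase γ 0).2 = p := by simp [phase, hd]
  rw [distSq_eq_zero_iff (by rw [h1, hp1])]
  exact ⟨0 + c, by rw [h1]; exact hγ 0⟩

end Radial

section UnitGeodesic

variable {n N : ℕ} {M : Type*} [TopologicalSpace M]
  [ChartedSpace (EuclideanSpace ℝ (Fin n)) M] {f : M → Amb N}

/-- The generatrix direction is tangent to the cone. -/
lemma smul_mem_tangentCone {x : Amb N} (hx : x ∈ cone f) (hx0 : x ≠ 0) (c : ℝ) :
    c • x ∈ tangentCone n f x := by
  obtain ⟨t, p, rfl⟩ := hx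
  refine Or.inr ⟨t, p, fun ht => hx0 (by rw [ht, zero_smul]), rfl, ?_⟩
  exact Submodule.mem_sup_left (Submodule.smul_mem _ _
    (Submodule.smul_mem _ _ (Submodule.mem_span_singleton_self _)))

/-- The conservation laws of the cone, for geodesics of the punctured cone on a time interval. -/
lemma conservation_of_isGeodesicAt {z : ℝ → Amb N × Amb N} {J : Set ℝ} (hJ : IsOpen J)
    (hJc : IsPreconnected J) (h0 : 0 ∈ J)
    (hz : ∀ s ∈ J, IsGeodesicAt (cone f \ {0}) (tangentCone n f) z s) (hunit : ‖(z 0).2‖ = 1)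
    {s : ℝ} (hs : s ∈ J) :
    ‖(z s).2‖ = 1 ∧
      ‖(z s).1‖ ^ 2 = (s + ⟪(z 0).1, (z 0).2⟫) ^ 2 + distSq (z 0) := by
  have hu : ∀ s ∈ J, ‖(z s).2‖ = 1 := fun s hs => by
    rw [← hunit]
    exact norm_eq_of_inner_deriv_eq_zero hJ hJc (fun t ht => (hz t ht).hasDerivAt_snd)
      (fun t ht => (hz t ht).orthogonal _ (hz t ht).mem.2) hs h0
  refine ⟨hu s hs, ?_⟩
  rw [distSq_of_norm_eq_one hunit]
  refine (inner_eq_and_normSq_eq hJ hJc h0 (fun t ht => (hz t ht).hasDerivAt_fst)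
    (fun t ht => (hz t ht).hasDerivAt_snd) hu (fun t ht => ?_) hs).2
  have hm := (hz t ht).mem.1
  have := smul_mem_tangentCone (n := n) hm.1 hm.2 1
  rw [one_smul] at this
  exact (hz t ht).orthogonal _ this

namespace IsUnitGeodesic

variable {γ δ : ℝ → Amb N}

lemma hasDerivAt (h : IsUnitGeodesic n f γ) (s : ℝ) : HasDerivAt γ (deriv γ s) s :=
  (h.contDiff.differentiable (by norm_num) s).hasDerivAt

lemma contDiff_deriv (h : IsUnitGeodesic n f γ) : ContDiff ℝ 1 (deriv γ) := by
  have h1 : ContDiff ℝ (1 + 1) γ := by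
    rw [one_add_one_eq_two]
    exact h.contDiff
  exact (contDiff_succ_iff_deriv.1 h1).2.2

lemma hasDerivAt_deriv (h : IsUnitGeodesic n f γ) (s : ℝ) :
    HasDerivAt (deriv γ) (deriv (deriv γ) s) s :=
  (h.contDiff_deriv.differentiable one_ne_zero s).hasDerivAt

lemma conservation (h : IsUnitGeodesic n f γ) (s : ℝ) :
    ⟪γ s, deriv γ s⟫ = s + ⟪γ 0, deriv γ 0⟫ ∧
      ‖γ s‖ ^ 2 = (s + ⟪γ 0, deriv γ 0⟫) ^ 2 + distSq (phase γ 0) := by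
  rw [distSq_of_norm_eq_one (z := phase γ 0) (h.unit_speed 0)]
  refine inner_eq_and_normSq_eq isOpen_univ isPreconnected_univ (mem_univ 0)
    (fun s _ => h.hasDerivAt s) (fun s _ => h.hasDerivAt_deriv s) (fun s _ => h.unit_speed s)
    (fun s _ => ?_) (mem_univ s)
  by_cases h0 : γ s = 0
  · rw [h0, inner_zero_right]
  · have := smul_mem_tangentCone (n := n) (h.mem_cone s) h0 1
    rw [one_smul] at this
    exact h.orthogonal s h0 _ this

lemma distSq_phase (h : IsUnitGeodesic n f γ) (s : ℝ) :
    distSq (phase γ s) = distSq (phase γ 0) := by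
  obtain ⟨h1, h2⟩ := h.conservation s
  rw [distSq_of_norm_eq_one (z := phase γ s) (h.unit_speed s)]
  change ‖γ s‖ ^ 2 - ⟪γ s, deriv γ s⟫ ^ 2 = _
  rw [h1, h2]
  ring

lemma distSq_phase_nonneg (h : IsUnitGeodesic n f γ) : 0 ≤ distSq (phase γ 0) :=
  distSq_nonneg (z := phase γ 0) (h.unit_speed 0)

lemma comp_add_const (h : IsUnitGeodesic n f γ) (c : ℝ) :
    IsUnitGeodesic n f (fun s => γ (s + c)) := by
  have h1 : deriv (fun s => γ (s + c)) = fun s => deriv γ (s + c) :=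
    funext fun s => deriv_comp_add_const _ _ _
  refine ⟨h.contDiff.comp (contDiff_id.add contDiff_const), fun s => h.mem_cone _, fun s => ?_,
    fun s hs w hw => ?_⟩
  · rw [h1]
    exact h.unit_speed _
  · rw [h1, deriv_comp_add_const]
    exact h.orthogonal _ hs w hw

/-- A geodesic through the vertex is a straight line: `‖γ(s)‖ = |s - s₁|` and
`⟪γ(s), γ'(s)⟫ = s - s₁` force `γ(s) = (s - s₁) γ'(s)`, whence `γ'' = 0`. -/
lemma eq_smul_of_eq_zero (h : IsUnitGeodesic n f γ) {s₁ : ℝ} (hs₁ : γ s₁ = 0) (s t : ℝ) :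
    γ s = (s - s₁) • deriv γ t := by
  obtain ⟨h1, h2⟩ := h.conservation s₁
  rw [hs₁, inner_zero_left] at h1
  rw [hs₁, ← h1] at h2
  have hI : distSq (phase γ 0) = 0 := by simpa using h2.symm
  have hlin : ∀ s, γ s = (s - s₁) • deriv γ s := by
    intro s
    have h3 := norm_sub_inner_smul_sq (z := phase γ s) (h.unit_speed s)
    rw [h.distSq_phase, hI] at h3
    have h4 : γ s - ⟪γ s, deriv γ s⟫ • deriv γ s = 0 :=
      norm_eq_zero.1 (pow_eq_zero_iff two_ne_zero |>.1 h3)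
    rw [(h.conservation s).1, show s + ⟪γ 0, deriv γ 0⟫ = s - s₁ by linarith] at h4
    exact sub_eq_zero.1 h4
  have hacc : ∀ s, deriv (deriv γ) s = 0 := by
    have hc : Continuous (deriv (deriv γ)) := h.contDiff_deriv.continuous_deriv le_rfl
    refine fun s => congrFun (Continuous.ext_on (dense_compl_singleton s₁) hc
      (continuous_const (y := (0 : Amb N))) fun s hs => ?_) s
    have hd := (((hasDerivAt_id s).sub_const s₁).smul (h.hasDerivAt_deriv s))
    have hd' : HasDerivAt γ _ s := hd.congr_of_eventuallyEq (Eventually.of_forall hlin)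
    have := hd'.unique (h.hasDerivAt s)
    simp only [id, one_smul, add_eq_right] at this
    exact (smul_eq_zero.1 this).resolve_left (sub_ne_zero.2 hs)
  have hconst : deriv γ s = deriv γ t :=
    is_const_of_deriv_eq_zero (h.contDiff_deriv.differentiable one_ne_zero) hacc s t
  rw [← hconst]
  exact hlin s

lemma eq_zero_of_distSq_eq_zero (h : IsUnitGeodesic n f γ) (hI : distSq (phase γ 0) = 0) :
    γ (-⟪γ 0, deriv γ 0⟫) = 0 := by
  have := (h.conservation (-⟪γ 0, deriv γ 0⟫)).2
  rw [hI] at this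
  simpa using this

lemma ne_zero_of_distSq_ne_zero (h : IsUnitGeodesic n f γ) (hI : distSq (phase γ 0) ≠ 0) (s : ℝ) :
    γ s ≠ 0 := by
  intro hs
  rw [← h.distSq_phase s] at hI
  exact hI (by simp [distSq, phase, hs])

lemma isRadial_of_eq_zero (h : IsUnitGeodesic n f γ) {s₁ : ℝ} (hs₁ : γ s₁ = 0) :
    IsRadial f γ := by
  refine ⟨deriv γ s₁, ?_, h.unit_speed s₁, -s₁, fun s => ?_⟩
  · have := h.mem_cone (s₁ + 1)
    rwa [h.eq_smul_of_eq_zero hs₁ (s₁ + 1) s₁, add_sub_cancel_left, one_smul] at this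
  · rw [← sub_eq_add_neg]
    exact h.eq_smul_of_eq_zero hs₁ s s₁

lemma isRadial_of_distSq_eq_zero (h : IsUnitGeodesic n f γ) (hI : distSq (phase γ 0) = 0) :
    IsRadial f γ :=
  h.isRadial_of_eq_zero (h.eq_zero_of_distSq_eq_zero hI)

end IsUnitGeodesic

lemma IsRadial.isUnitGeodesic {γ : ℝ → Amb N} (h : IsRadial f γ) : IsUnitGeodesic n f γ := by
  obtain ⟨p, hp, hp1, c, hγ, hd⟩ := h.exists_deriv_eq
  have h1 : γ = fun s => (s + c) • p := funext hγ
  refine ⟨?_, fun s => ?_, fun s => ?_, fun s _ w _ => ?_⟩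
  · rw [h1]
    exact (contDiff_id.add contDiff_const).smul contDiff_const
  · rw [hγ]
    exact smul_mem_cone hp _
  · rw [hd, hp1]
  · rw [hd]
    simp

/-- A complete phase curve of the punctured cone with unit initial velocity is the phase curve of a
unit-speed geodesic. -/
lemma isUnitGeodesic_of_isGeodesicAt {z : ℝ → Amb N × Amb N}
    (hz : ∀ s, IsGeodesicAt (cone f \ {0}) (tangentCone n f) z s) (hunit : ‖(z 0).2‖ = 1) :
    IsUnitGeodesic n f (fun s => (z s).1) ∧ phase (fun s => (z s).1) = z := by
  have hd : deriv (fun s => (z s).1) = fun s => (z s).2 :=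
    funext fun s => (hz s).hasDerivAt_fst.deriv
  have hd2 : deriv (fun s => (z s).2) = fun s => (deriv z s).2 :=
    funext fun s => (hz s).hasDerivAt_snd.deriv
  have hzc : ContDiff ℝ 1 z := contDiff_iff_contDiffAt.2 fun s => (hz s).contDiffAt
  refine ⟨⟨?_, fun s => (hz s).mem.1.1, fun s => ?_, fun s _ w hw => ?_⟩, ?_⟩
  · rw [show (2 : WithTop ℕ∞) = 1 + 1 from one_add_one_eq_two.symm, contDiff_succ_iff_deriv]
    refine ⟨fun s => (hz s).hasDerivAt_fst.differentiableAt, by simp, ?_⟩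
    rw [hd]
    exact contDiff_snd.comp hzc
  · rw [hd]
    exact (conservation_of_isGeodesicAt isOpen_univ isPreconnected_univ (mem_univ 0)
      (fun s _ => hz s) hunit (mem_univ s)).1
  · rw [hd, hd2]
    exact (hz s).orthogonal w hw
  · funext s
    rw [phase, hd]

end UnitGeodesic

/-! ### Existence and uniqueness of geodesics of the cone -/

section Completeness

variable {n N : ℕ} {M : Type*} [TopologicalSpace M]
  [ChartedSpace (EuclideanSpace ℝ (Fin n)) M] [IsManifold (𝓡 n) 3 M]
  {g : Bundle.ContMDiffRiemannianMetric (𝓡 n) 2 (EuclideanSpace ℝ (Fin n))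
    (fun p : M => TangentSpace (𝓡 n) p)}
  {f : M → Amb N}

namespace IsUnitGeodesic

variable {γ δ : ℝ → Amb N}

/-- The phase curve of a geodesic that avoids the vertex is a geodesic of the punctured cone. -/
lemma isGeodesicAt_phase [T2Space M] [CompactSpace M] (hf : IsIsometricEmbeddingInPlane g f)
    (h : IsUnitGeodesic n f γ) (h0 : ∀ s, γ s ≠ 0) (s : ℝ) :
    IsGeodesicAt (cone f \ {0}) (tangentCone n f) (phase γ) s where
  mem := ⟨⟨h.mem_cone s, h0 s⟩, hf.hasLocalCharts_cone.mem_tangent_of_hasDerivAt (h.hasDerivAt s)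
    (Eventually.of_forall fun t => ⟨h.mem_cone t, h0 t⟩)⟩
  contDiffAt := ((h.contDiff.of_le (by norm_num)).prodMk h.contDiff_deriv).contDiffAt
  deriv_fst := by
    have h1 : deriv (phase γ) s = _ := ((h.hasDerivAt s).prodMk (h.hasDerivAt_deriv s)).deriv
    rw [h1]
    rfl
  orthogonal := by
    have h1 : deriv (phase γ) s = _ := ((h.hasDerivAt s).prodMk (h.hasDerivAt_deriv s)).deriv
    rw [h1]
    exact h.orthogonal s (h0 s)

lemma phase_mem_unitTangent [T2Space M] [CompactSpace M] (hf : IsIsometricEmbeddingInPlane g f)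
    (h : IsUnitGeodesic n f γ) (s : ℝ) : phase γ s ∈ unitTangent n f := by
  refine ⟨h.mem_cone s, ?_, h.unit_speed s⟩
  change deriv γ s ∈ tangentCone n f (γ s)
  by_cases hI : distSq (phase γ 0) = 0
  · set s₁ := -⟪γ 0, deriv γ 0⟫ with hs₁
    have hz : γ s₁ = 0 := h.eq_zero_of_distSq_eq_zero hI
    have hlin := fun t => h.eq_smul_of_eq_zero hz t s
    have hmem : deriv γ s ∈ cone f := by
      have := h.mem_cone (s₁ + 1)
      rwa [hlin, add_sub_cancel_left, one_smul] at this
    by_cases hss : s = s₁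
    · rw [hss, hz, hf.tangentCone_zero, ← hss]
      exact hmem
    · have hss' : s - s₁ ≠ 0 := sub_ne_zero.2 hss
      have hne : γ s ≠ 0 := fun h' => by
        rw [hlin s, smul_eq_zero_iff_right hss'] at h'
        have := h.unit_speed s
        rw [h', norm_zero] at this
        exact zero_ne_one this
      have := smul_mem_tangentCone (n := n) (h.mem_cone s) hne (s - s₁)⁻¹
      have h5 : (s - s₁)⁻¹ • γ s = deriv γ s := by
        rw [hlin s, inv_smul_smul₀ hss']
      rwa [h5] at this
  · exact (h.isGeodesicAt_phase hf (h.ne_zero_of_distSq_ne_zero hI) s).mem.2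

/-- A geodesic is determined by its initial phase point. -/
lemma eq_of_phase_eq [T2Space M] [CompactSpace M] (hf : IsIsometricEmbeddingInPlane g f)
    (h : IsUnitGeodesic n f γ) (h' : IsUnitGeodesic n f δ) (heq : phase γ 0 = phase δ 0) :
    γ = δ := by
  have h1 : γ 0 = δ 0 := congrArg Prod.fst heq
  have h2 : deriv γ 0 = deriv δ 0 := congrArg Prod.snd heq
  by_cases hI : distSq (phase γ 0) = 0
  · have h3 := h.eq_zero_of_distSq_eq_zero hI
    have h4 := h'.eq_zero_of_distSq_eq_zero (heq ▸ hI)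
    rw [← h1, ← h2] at h4
    funext s
    rw [h.eq_smul_of_eq_zero h3 s 0, h'.eq_smul_of_eq_zero h4 s 0, h2]
  · have h3 := hf.hasLocalCharts_cone.eqOn_of_isGeodesicAt isOpen_univ isPreconnected_univ
      (fun s _ => h.isGeodesicAt_phase hf (h.ne_zero_of_distSq_ne_zero hI) s)
      (fun s _ => h'.isGeodesicAt_phase hf (h'.ne_zero_of_distSq_ne_zero (heq ▸ hI)) s)
      (mem_univ 0) heq
    funext s
    exact congrArg Prod.fst (h3 (mem_univ s))

end IsUnitGeodesic

/-- Completeness: a non-radial geodesic keeps the positive distance `√I` from the vertex, so that it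
stays in a compact part of the tangent bundle of the punctured cone. -/
lemma exists_isUnitGeodesic_of_distSq_ne_zero [T2Space M] [CompactSpace M]
    (hf : IsIsometricEmbeddingInPlane g f) {z₀ : Amb N × Amb N} (hz₀ : z₀ ∈ unitTangent n f)
    (hI : distSq z₀ ≠ 0) : ∃ γ, IsUnitGeodesic n f γ ∧ phase γ 0 = z₀ := by
  have hunit : ‖z₀.2‖ = 1 := hz₀.2.2
  have hIpos : 0 < distSq z₀ := lt_of_le_of_ne (distSq_nonneg hunit) (Ne.symm hI)
  have hx₀ : z₀.1 ≠ 0 := fun h => hI (by simp [distSq, h])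
  have hW := hf.hasLocalCharts_cone
  obtain ⟨z, hz0, hz⟩ := hW.exists_isGeodesicAt (z₀ := z₀) (fun R hR => by
    set b := ⟪z₀.1, z₀.2⟫ with hb
    let S : Set (Amb N × Amb N) := {z | z ∈ tangentBundle (cone f \ {0}) (tangentCone n f) ∧
      ‖z.2‖ = 1 ∧ distSq z₀ ≤ ‖z.1‖ ^ 2 ∧ ‖z.1‖ ^ 2 ≤ (R + |b|) ^ 2 + distSq z₀}
    have hclosed : IsClosed S := by
      let A : Set (Amb N × Amb N) := {z | z.1 ∈ cone f ∧
        ‖z.2‖ = 1 ∧ distSq z₀ ≤ ‖z.1‖ ^ 2 ∧ ‖z.1‖ ^ 2 ≤ (R + |b|) ^ 2 + distSq z₀}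
      have hA : IsClosed A := by
        have hc1 : Continuous fun z : Amb N × Amb N => ‖z.1‖ ^ 2 := by fun_prop
        have hc2 : Continuous fun z : Amb N × Amb N => ‖z.2‖ := by fun_prop
        exact (hf.isClosed_cone.preimage continuous_fst).inter
          ((isClosed_eq hc2 continuous_const).inter
            ((isClosed_le continuous_const hc1).inter (isClosed_le hc1 continuous_const)))
      refine isClosed_of_closure_subset fun z hz => ?_
      have hzA : z ∈ A := closure_minimal (fun z hz => ⟨hz.1.1.1, hz.2⟩ : S ⊆ A) hA hz
      refine ⟨hW.mem_tangentBundle_of_mem_closure (closure_mono (fun z hz => hz.1) hz)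
        ⟨hzA.1, fun h0 => ?_⟩, hzA.2⟩
      have h0' : z.1 = 0 := h0
      have := hzA.2.2.1
      rw [h0', norm_zero] at this
      linarith
    refine ⟨S, isCompact_of_isClosed_isBounded hclosed ?_, fun z hz => hz.1, ?_, ?_⟩
    · rw [isBounded_iff_forall_norm_le]
      refine ⟨(R + |b|) ^ 2 + distSq z₀ + 1, fun z hz => ?_⟩
      rw [Prod.norm_def, max_le_iff]
      constructor
      · nlinarith [hz.2.2.2, sq_nonneg (‖z.1‖ - 1)]
      · rw [hz.2.1]
        nlinarith [sq_nonneg (R + |b|)]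
    · have h1 := distSq_of_norm_eq_one hunit
      rw [← hb] at h1
      refine ⟨⟨⟨hz₀.1, hx₀⟩, hz₀.2.1⟩, hunit, by nlinarith [sq_nonneg b], ?_⟩
      have h2 : b ^ 2 ≤ (R + |b|) ^ 2 := by
        rw [← sq_abs b]
        have := abs_nonneg b
        gcongr
        linarith
      linarith
    · intro z r hz0 hz s hs hsR
      have h0 : (0 : ℝ) ∈ Ioo (-r) r := ⟨by linarith [hs.1, hs.2], by linarith [hs.1, hs.2]⟩
      obtain ⟨h1, h2⟩ := conservation_of_isGeodesicAt isOpen_Ioo isPreconnected_Ioo h0 hz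
        (by rw [hz0, hunit]) hs
      rw [hz0, ← hb] at h2
      refine ⟨(hz s hs).mem, h1, by rw [h2]; nlinarith [sq_nonneg (s + b)], ?_⟩
      rw [h2, ← sq_abs (s + b)]
      have := (abs_add_le s b).trans (add_le_add_left hsR |b|)
      gcongr)
  obtain ⟨h1, h2⟩ := isUnitGeodesic_of_isGeodesicAt hz (by rw [hz0, hunit])
  exact ⟨_, h1, by rw [h2, hz0]⟩

lemma exists_isUnitGeodesic [T2Space M] [CompactSpace M] (hf : IsIsometricEmbeddingInPlane g f)
    {z : Amb N × Amb N} (hz : z ∈ unitTangent n f) :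
    ∃ γ, IsUnitGeodesic n f γ ∧ phase γ 0 = z := by
  by_cases hI : distSq z = 0
  · obtain ⟨k, hk⟩ := (distSq_eq_zero_iff hz.2.2).1 hI
    have hv : z.2 ∈ cone f := by
      by_cases hk0 : k = 0
      · have hz1 : z.1 = 0 := by rw [hk, hk0, zero_smul]
        have := hz.2.1
        rwa [hz1, hf.tangentCone_zero] at this
      · have := smul_mem_cone hz.1 k⁻¹
        rwa [hk, inv_smul_smul₀ hk0] at this
    have hr : IsRadial f (fun s => (s + k) • z.2) := ⟨z.2, hv, hz.2.2, k, fun _ => rfl⟩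
    refine ⟨_, hr.isUnitGeodesic, ?_⟩
    have hd : HasDerivAt (fun s : ℝ => (s + k) • z.2) z.2 0 := by
      simpa using ((hasDerivAt_id (0 : ℝ)).add_const k).smul_const z.2
    refine Prod.ext ?_ hd.deriv
    change (0 + k) • z.2 = z.1
    rw [zero_add, hk]
  · exact exists_isUnitGeodesic_of_distSq_ne_zero hf hz hI

theorem flowWellDefined [T2Space M] [CompactSpace M] (hf : IsIsometricEmbeddingInPlane g f) :
    FlowWellDefined n f := by
  refine ⟨fun z hz => ?_, fun γ h s => h.phase_mem_unitTangent hf s⟩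
  obtain ⟨γ, hγ, hγ0⟩ := exists_isUnitGeodesic hf hz
  exact ⟨γ, ⟨hγ, hγ0⟩, fun δ hδ => hδ.1.eq_of_phase_eq hf hγ (hδ.2.trans hγ0.symm)⟩

end Completeness

/-! ### The first integrals -/

section PhaseCoord

variable {N : ℕ}

/-- The coordinates of a phase point: first those of the position, then those of the velocity. -/
noncomputable def phaseCoord (k : Fin (2 * N + 2)) : Amb N × Amb N →L[ℝ] ℝ :=
  if h : k.1 < N + 1 then
    (EuclideanSpace.proj (⟨k, h⟩ : Fin (N + 1)) : Amb N →L[ℝ] ℝ) ∘L .fst ℝ _ _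
  else
    (EuclideanSpace.proj (⟨k - (N + 1), by omega⟩ : Fin (N + 1)) : Amb N →L[ℝ] ℝ) ∘L .snd ℝ _ _

lemma phaseCoord_position (j : Fin (N + 1)) (h : (j : ℕ) < 2 * N + 2) (y : Amb N × Amb N) :
    phaseCoord ⟨j, h⟩ y = y.1 j := by
  rw [phaseCoord, dif_pos j.2]
  rfl

lemma phaseCoord_velocity (j : Fin (N + 1)) (h : N + 1 + (j : ℕ) < 2 * N + 2)
    (y : Amb N × Amb N) : phaseCoord ⟨N + 1 + j, h⟩ y = y.2 j := by
  rw [phaseCoord, dif_neg (by dsimp only; omega)]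
  have hj : (⟨N + 1 + j - (N + 1), by omega⟩ : Fin (N + 1)) = j := Fin.ext (by simp)
  exact congrArg (fun i => y.2 i) hj

lemma abs_phaseCoord_le (k : Fin (2 * N + 2)) (y : Amb N × Amb N) :
    |phaseCoord k y| ≤ max ‖y.1‖ ‖y.2‖ := by
  rw [phaseCoord]
  split_ifs with h
  · exact (PiLp.norm_apply_le y.1 _).trans (le_max_left _ _)
  · exact (PiLp.norm_apply_le y.2 _).trans (le_max_right _ _)

lemma eq_of_forall_phaseCoord_eq {y y' : Amb N × Amb N}
    (h : ∀ k, phaseCoord k y = phaseCoord k y') :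
    y = y' := by
  refine Prod.ext (PiLp.ext fun j => ?_) (PiLp.ext fun j => ?_)
  · rw [← phaseCoord_position j (by omega), h, phaseCoord_position]
  · rw [← phaseCoord_velocity j (by omega), h, phaseCoord_velocity]

end PhaseCoord

section Integrals

variable (n : ℕ) {N : ℕ} {M : Type*} [TopologicalSpace M]
  [ChartedSpace (EuclideanSpace ℝ (Fin n)) M]

/-- The unit-speed geodesic with initial phase point `z`; an arbitrary curve if `z ∉ T¹K`. -/
noncomputable def geodesicFrom (f : M → Amb N) (z : Amb N × Amb N) : ℝ → Amb N :=
  Classical.epsilon fun γ => IsUnitGeodesic n f γ ∧ phase γ 0 = z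

/-- The phase point at which the geodesic through `z` is closest to the vertex. -/
noncomputable def tangencyPoint (f : M → Amb N) (z : Amb N × Amb N) : Amb N × Amb N :=
  phase (geodesicFrom n f z) (-⟪z.1, z.2⟫)

/-- The coordinates of `I γ(s₀)` and `I γ'(s₀)`, where `γ` is the geodesic through `z` and `s₀` the
time at which it is closest to the vertex. -/
noncomputable def tangencyIntegral (f : M → Amb N) (k : Fin (2 * N + 2)) (z : Amb N × Amb N) : ℝ :=
  distSq z * phaseCoord k (tangencyPoint n f z)

end Integrals

section NonRadial

variable {n N : ℕ} {M : Type*} [TopologicalSpace M]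
  [ChartedSpace (EuclideanSpace ℝ (Fin n)) M] {f : M → Amb N}

lemma mem_nonRadial_iff {z : Amb N × Amb N} :
    z ∈ nonRadial n f ↔ z ∈ unitTangent n f ∧ distSq z ≠ 0 := by
  constructor
  · rintro ⟨h1, h2⟩
    refine ⟨h1, fun h => ?_⟩
    obtain ⟨k, hk⟩ := (distSq_eq_zero_iff h1.2.2).1 h
    exact h2 k hk
  · rintro ⟨h1, h2⟩
    exact ⟨h1, fun k hk => h2 ((distSq_eq_zero_iff h1.2.2).2 ⟨k, hk⟩)⟩

end NonRadial

section FirstIntegrals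

variable {n N : ℕ} {M : Type*} [TopologicalSpace M] [T2Space M] [CompactSpace M]
  [ChartedSpace (EuclideanSpace ℝ (Fin n)) M] [IsManifold (𝓡 n) 3 M]
  {g : Bundle.ContMDiffRiemannianMetric (𝓡 n) 2 (EuclideanSpace ℝ (Fin n))
    (fun p : M => TangentSpace (𝓡 n) p)}
  {f : M → Amb N}

lemma geodesicFrom_spec (hf : IsIsometricEmbeddingInPlane g f) {z : Amb N × Amb N}
    (hz : z ∈ unitTangent n f) :
    IsUnitGeodesic n f (geodesicFrom n f z) ∧ phase (geodesicFrom n f z) 0 = z :=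
  Classical.epsilon_spec (exists_isUnitGeodesic hf hz)

lemma geodesicFrom_phase (hf : IsIsometricEmbeddingInPlane g f) {γ : ℝ → Amb N}
    (h : IsUnitGeodesic n f γ) (s : ℝ) :
    geodesicFrom n f (phase γ s) = fun t => γ (t + s) := by
  obtain ⟨h1, h2⟩ := geodesicFrom_spec hf (h.phase_mem_unitTangent hf s)
  refine h1.eq_of_phase_eq hf (h.comp_add_const s) ?_
  rw [h2, phase_comp_add_const, zero_add]

lemma tangencyPoint_phase (hf : IsIsometricEmbeddingInPlane g f) {γ : ℝ → Amb N}
    (h : IsUnitGeodesic n f γ) (s : ℝ) :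
    tangencyPoint n f (phase γ s) = phase γ (-⟪γ 0, deriv γ 0⟫) := by
  rw [tangencyPoint, geodesicFrom_phase hf h, phase_comp_add_const]
  congr 1
  have := (h.conservation s).1
  simp only [phase]
  linarith

lemma isFirstIntegral_tangencyIntegral (hf : IsIsometricEmbeddingInPlane g f)
    (k : Fin (2 * N + 2)) : IsFirstIntegral n f (tangencyIntegral n f k) := by
  intro γ h s
  rw [tangencyIntegral, tangencyIntegral, tangencyPoint_phase hf h, tangencyPoint_phase hf h,
    h.distSq_phase]

lemma isGeodesicAt_geodesicFrom (hf : IsIsometricEmbeddingInPlane g f) {z : Amb N × Amb N}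
    (hz : z ∈ nonRadial n f) (s : ℝ) :
    IsGeodesicAt (cone f \ {0}) (tangentCone n f) (phase (geodesicFrom n f z)) s := by
  obtain ⟨h1, h2⟩ := mem_nonRadial_iff.1 hz
  obtain ⟨h3, h4⟩ := geodesicFrom_spec hf h1
  exact h3.isGeodesicAt_phase hf (h3.ne_zero_of_distSq_ne_zero (by rwa [h4])) s

/-- Near each phase point of a non-radial geodesic, the geodesic flow for small times is the
restriction of a `C¹` map of the ambient space. -/
lemma exists_localFlow_geodesicFrom (hf : IsIsometricEmbeddingInPlane g f) {z₀ : Amb N × Amb N}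
    (hz₀ : z₀ ∈ nonRadial n f) (t₀ : ℝ) :
    ∃ Θ : (Amb N × Amb N) × ℝ → Amb N × Amb N, ∃ O : Set (Amb N × Amb N), IsOpen O ∧
      phase (geodesicFrom n f z₀) t₀ ∈ O ∧ ∃ ε > 0,
        (∀ z ∈ O, ∀ s ∈ Ioo (-ε) ε, ContDiffAt ℝ 1 Θ (z, s)) ∧
        ∀ z ∈ nonRadial n f, ∀ t, phase (geodesicFrom n f z) t ∈ O → ∀ s ∈ Ioo (-ε) ε,
          Θ (phase (geodesicFrom n f z) t, s) = phase (geodesicFrom n f z) (t + s) := by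
  have hW := hf.hasLocalCharts_cone
  obtain ⟨Θ, O, hO, hmem, ε, hε, hΘ, hΘg⟩ :=
    hW.exists_localFlow (isGeodesicAt_geodesicFrom hf hz₀ t₀).mem
  refine ⟨Θ, O, hO, hmem, ε, hε, hΘ, fun z hz t ht s hs => ?_⟩
  obtain ⟨h0, hg⟩ := hΘg _ ⟨ht, (isGeodesicAt_geodesicFrom hf hz t).mem⟩
  have h1 := hW.eqOn_of_isGeodesicAt isOpen_Ioo isPreconnected_Ioo hg
    (fun s _ => (isGeodesicAt_geodesicFrom hf hz (s + t)).comp_add_const)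
    (s₀ := 0) ⟨by linarith, hε⟩ (by rw [h0, zero_add])
  rw [add_comm]
  exact h1 hs

/-- The geodesic flow for a fixed time is `C¹` on `𝒯`. The set of times with this property is open
and closed, as the flow for a small time difference is `C¹`. -/
lemma exists_contDiffAt_flow (hf : IsIsometricEmbeddingInPlane g f) {z₀ : Amb N × Amb N}
    (hz₀ : z₀ ∈ nonRadial n f) (t : ℝ) :
    ∃ G : Amb N × Amb N → Amb N × Amb N, ContDiffAt ℝ 1 G z₀ ∧
      ∀ᶠ z in 𝓝 z₀, z ∈ nonRadial n f → G z = phase (geodesicFrom n f z) t := by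
  let P : ℝ → Prop := fun t => ∃ G : Amb N × Amb N → Amb N × Amb N, ContDiffAt ℝ 1 G z₀ ∧
      ∀ᶠ z in 𝓝 z₀, z ∈ nonRadial n f → G z = phase (geodesicFrom n f z) t
  have hP0 : P 0 := ⟨id, contDiffAt_id, Eventually.of_forall fun z hz =>
    (geodesicFrom_spec hf hz.1).2.symm⟩
  have hstep : ∀ t₀, ∀ᶠ t in 𝓝 t₀, (P t₀ → P t) ∧ (P t → P t₀) := by
    intro t₀
    obtain ⟨Θ, O, hO, hmem, ε, hε, hΘ, hflow⟩ := exists_localFlow_geodesicFrom hf hz₀ t₀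
    have key : ∀ t t', phase (geodesicFrom n f z₀) t ∈ O → t' - t ∈ Ioo (-ε) ε → P t → P t' := by
      rintro t t' htO ht ⟨G, hG, hGeq⟩
      have hG0 : G z₀ = phase (geodesicFrom n f z₀) t := hGeq.self_of_nhds hz₀
      refine ⟨fun z => Θ (G z, t' - t), ?_, ?_⟩
      · exact ContDiffAt.comp z₀ (hΘ (G z₀) (hG0 ▸ htO) _ ht) (hG.prodMk contDiffAt_const)
      · filter_upwards [hGeq, hG.continuousAt.eventually_mem (hO.mem_nhds (hG0 ▸ htO))]
          with z hz hzO hzN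
        rw [hz hzN] at hzO ⊢
        rw [hflow z hzN t hzO _ ht, add_sub_cancel]
    have hcont : ContinuousAt (phase (geodesicFrom n f z₀)) t₀ :=
      (isGeodesicAt_geodesicFrom hf hz₀ t₀).contDiffAt.continuousAt
    filter_upwards [hcont.eventually_mem (hO.mem_nhds hmem),
      Ioo_mem_nhds (show t₀ - ε < t₀ by linarith) (show t₀ < t₀ + ε by linarith)] with t htO ht
    exact ⟨key t₀ t hmem ⟨by linarith [ht.1], by linarith [ht.2]⟩,
      key t t₀ htO ⟨by linarith [ht.2], by linarith [ht.1]⟩⟩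
  exact isPreconnected_univ.induction₂' (fun s t => P s → P t)
    (fun s _ => (hstep s).filter_mono nhdsWithin_le_nhds) (fun _ _ _ _ _ _ h h' => h' ∘ h)
    (mem_univ 0) (mem_univ t) hP0

lemma exists_contDiffAt_tangencyPoint (hf : IsIsometricEmbeddingInPlane g f) {z₀ : Amb N × Amb N}
    (hz₀ : z₀ ∈ nonRadial n f) :
    ∃ G : Amb N × Amb N → Amb N × Amb N, ContDiffAt ℝ 1 G z₀ ∧
      ∀ᶠ z in 𝓝 z₀, z ∈ nonRadial n f → G z = tangencyPoint n f z := by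
  set t := -⟪z₀.1, z₀.2⟫ with ht
  obtain ⟨G, hG, hGeq⟩ := exists_contDiffAt_flow hf hz₀ t
  obtain ⟨Θ, O, hO, hmem, ε, hε, hΘ, hflow⟩ := exists_localFlow_geodesicFrom hf hz₀ t
  have hG0 : G z₀ = phase (geodesicFrom n f z₀) t := hGeq.self_of_nhds hz₀
  have hτ : ContDiffAt ℝ 1 (fun z : Amb N × Amb N => -⟪z.1, z.2⟫ - t) z₀ :=
    (contDiffAt_fst.inner ℝ contDiffAt_snd).neg.sub contDiffAt_const
  have hτ0 : -⟪z₀.1, z₀.2⟫ - t ∈ Ioo (-ε) ε := by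
    rw [← ht, sub_self]
    exact ⟨by linarith, hε⟩
  refine ⟨fun z => Θ (G z, -⟪z.1, z.2⟫ - t), ?_, ?_⟩
  · exact ContDiffAt.comp z₀ (hΘ (G z₀) (hG0 ▸ hmem) _ hτ0) (hG.prodMk hτ)
  · filter_upwards [hGeq, hG.continuousAt.eventually_mem (hO.mem_nhds (hG0 ▸ hmem)),
      hτ.continuousAt.eventually_mem (Ioo_mem_nhds hτ0.1 hτ0.2)] with z hz hzO hzτ hzN
    rw [hz hzN] at hzO ⊢
    rw [hflow z hzN t hzO _ hzτ, add_sub_cancel]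
    rfl

lemma isC1On_tangencyIntegral (hf : IsIsometricEmbeddingInPlane g f) (k : Fin (2 * N + 2)) :
    IsC1On (tangencyIntegral n f k) (nonRadial n f) := by
  intro z hz
  obtain ⟨G, hG, hGeq⟩ := exists_contDiffAt_tangencyPoint hf hz
  have h1 : ContDiffAt ℝ 1 (fun z => distSq z * phaseCoord k (G z)) z :=
    (contDiffAt_distSq hz.1.2.2).mul ((phaseCoord k).contDiff.contDiffAt.comp z hG)
  obtain ⟨U, hU, hUo, hzU⟩ := _root_.eventually_nhds_iff.1 ((h1.eventually (by simp)).and hGeq)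
  refine ⟨U, fun z => distSq z * phaseCoord k (G z), hUo, hzU,
    fun y hy => (hU y hy).1.contDiffWithinAt, fun y hy => ?_⟩
  rw [tangencyIntegral, ← (hU y hy.2).2 hy.1]

lemma norm_tangencyPoint (hf : IsIsometricEmbeddingInPlane g f) {z : Amb N × Amb N}
    (hz : z ∈ unitTangent n f) :
    ‖(tangencyPoint n f z).1‖ ^ 2 = distSq z ∧ ‖(tangencyPoint n f z).2‖ = 1 := by
  obtain ⟨h1, h2⟩ := geodesicFrom_spec hf hz
  have h3 := tangencyPoint_phase hf h1 0
  rw [h2] at h3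
  rw [h3]
  refine ⟨?_, h1.unit_speed _⟩
  have h4 := (h1.conservation (-⟪geodesicFrom n f z 0, deriv (geodesicFrom n f z) 0⟫)).2
  rw [h2, neg_add_cancel] at h4
  simpa [phase] using h4

lemma abs_tangencyIntegral_le (hf : IsIsometricEmbeddingInPlane g f) (k : Fin (2 * N + 2))
    {z : Amb N × Amb N} (hz : z ∈ unitTangent n f) :
    |tangencyIntegral n f k z| ≤ distSq z * (distSq z + 1) := by
  obtain ⟨h1, h2⟩ := norm_tangencyPoint hf hz
  have h0 := distSq_nonneg hz.2.2
  rw [tangencyIntegral, abs_mul, abs_of_nonneg h0]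
  refine mul_le_mul_of_nonneg_left ((abs_phaseCoord_le _ _).trans (max_le ?_ ?_)) h0
  · nlinarith [sq_nonneg (‖(tangencyPoint n f z).1‖ - 1)]
  · linarith

lemma continuousOn_tangencyIntegral (hf : IsIsometricEmbeddingInPlane g f) (k : Fin (2 * N + 2)) :
    ContinuousOn (tangencyIntegral n f k) (unitTangent n f) := by
  intro z₀ hz₀
  have hI : ContinuousAt distSq z₀ := (contDiffAt_distSq hz₀.2.2).continuousAt
  by_cases h0 : distSq z₀ = 0
  · have h1 : tangencyIntegral n f k z₀ = 0 := by rw [tangencyIntegral, h0, zero_mul]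
    rw [ContinuousWithinAt, h1]
    have h2 : Tendsto (fun z => distSq z * (distSq z + 1)) (𝓝[unitTangent n f] z₀) (𝓝 0) := by
      have h3 : ContinuousAt (fun z => distSq z * (distSq z + 1)) z₀ :=
        hI.mul (hI.add continuousAt_const)
      have h4 := h3.tendsto
      rw [h0, zero_mul] at h4
      exact h4.mono_left nhdsWithin_le_nhds
    refine squeeze_zero_norm' ?_ h2
    filter_upwards [self_mem_nhdsWithin] with z hz using abs_tangencyIntegral_le hf k hz
  · have hN : z₀ ∈ nonRadial n f := mem_nonRadial_iff.2 ⟨hz₀, h0⟩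
    obtain ⟨U, G, hU, hzU, hG, heq⟩ := isC1On_tangencyIntegral hf k z₀ hN
    have h1 : ContinuousWithinAt G (unitTangent n f) z₀ :=
      (hG.continuousOn.continuousAt (hU.mem_nhds hzU)).continuousWithinAt
    refine h1.congr_of_eventuallyEq ?_ (heq z₀ ⟨hN, hzU⟩)
    filter_upwards [self_mem_nhdsWithin, nhdsWithin_le_nhds (hU.mem_nhds hzU),
      nhdsWithin_le_nhds (hI.eventually_ne h0)] with z hz hzU hz0
    exact heq z ⟨mem_nonRadial_iff.2 ⟨hz, hz0⟩, hzU⟩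

/-- The integrals separate the non-radial geodesics: they determine `I` as the length of the second
vector `I γ'(s₀)`, hence the phase point `(γ(s₀), γ'(s₀))`. -/
lemma eq_of_tangencyIntegral_eq (hf : IsIsometricEmbeddingInPlane g f) {z w : Amb N × Amb N}
    (hz : z ∈ unitTangent n f) (hw : w ∈ unitTangent n f)
    (h : ∀ k, tangencyIntegral n f k z = tangencyIntegral n f k w) :
    distSq z = distSq w ∧ (distSq z ≠ 0 → tangencyPoint n f z = tangencyPoint n f w) := by
  have h1 : distSq z • tangencyPoint n f z = distSq w • tangencyPoint n f w :=
    eq_of_forall_phaseCoord_eq fun k => by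
      rw [map_smul, map_smul]
      exact h k
  have hnorm : ∀ {z : Amb N × Amb N}, z ∈ unitTangent n f →
      ‖(distSq z • tangencyPoint n f z).2‖ = distSq z := fun {z} hz => by
    rw [Prod.smul_snd, norm_smul, (norm_tangencyPoint hf hz).2, mul_one,
      Real.norm_of_nonneg (distSq_nonneg hz.2.2)]
  have h2 : distSq z = distSq w := by rw [← hnorm hz, h1, hnorm hw]
  refine ⟨h2, fun h0 => ?_⟩
  rw [← h2] at h1
  exact smul_right_injective _ h0 h1

end FirstIntegrals

end ConeGeodesic

open ConeGeodesic in
theorem theorem1 {n N : ℕ} {M : Type*} [TopologicalSpace M] [T2Space M] [CompactSpace M]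
    [ChartedSpace (EuclideanSpace ℝ (Fin n)) M] [IsManifold (𝓡 n) 3 M]
    (g : Bundle.ContMDiffRiemannianMetric (𝓡 n) 2 (EuclideanSpace ℝ (Fin n))
      (fun p : M => TangentSpace (𝓡 n) p))
    (f : M → Amb N) (hf : IsIsometricEmbeddingInPlane g f) :
    FlowWellDefined n f ∧
    ∃ I : Fin (2 * N + 2) → Amb N × Amb N → ℝ,
      -- continuous first integrals on `T¹K`, of class `C¹` on `𝒯`
      (∀ k, ContinuousOn (I k) (unitTangent n f)) ∧
      (∀ k, IsFirstIntegral n f (I k)) ∧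
      (∀ k, IsC1On (I k) (nonRadial n f)) ∧
      -- each nonzero value determines a unique geodesic (up to a shift of the parameter)
      (∀ y ∈ (fun z k => I k z) '' unitTangent n f, y ≠ 0 →
        ∃ γ : ℝ → Amb N, IsUnitGeodesic n f γ ∧
          ∀ δ : ℝ → Amb N, IsUnitGeodesic n f δ →
            ((∀ k, I k (phase δ 0) = y k) ↔ ∃ c : ℝ, ∀ s, δ s = γ (s + c))) ∧
      -- the origin corresponds exactly to the radial geodesics
      (∀ γ : ℝ → Amb N,
        (IsUnitGeodesic n f γ ∧ ∀ k, I k (phase γ 0) = 0) ↔ IsRadial f γ) ∧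
      -- the integrals are `I` times position and velocity at the point of tangency
      (∀ γ : ℝ → Amb N, IsUnitGeodesic n f γ → ¬ IsRadial f γ →
        0 < distSq (phase γ 0) ∧ (∀ s, distSq (phase γ s) = distSq (phase γ 0)) ∧
        ∃ s₀ : ℝ,
          (∀ s, Touches γ (Real.sqrt (distSq (phase γ 0))) s ↔ s = s₀) ∧
          ∀ j : Fin (N + 1),
            I ⟨j, by omega⟩ (phase γ 0) = distSq (phase γ 0) * γ s₀ j ∧
            I ⟨N + 1 + j, by omega⟩ (phase γ 0) = distSq (phase γ 0) * deriv γ s₀ j) := by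
  refine ⟨flowWellDefined hf, tangencyIntegral n f, continuousOn_tangencyIntegral hf,
    isFirstIntegral_tangencyIntegral hf, isC1On_tangencyIntegral hf, ?_, fun γ => ⟨?_, ?_⟩, ?_⟩
  · rintro _ ⟨z, hz, rfl⟩ hy
    have hI : distSq z ≠ 0 := fun h => hy (by funext k; simp [tangencyIntegral, h])
    obtain ⟨hγ, hγ0⟩ := geodesicFrom_spec hf hz
    set γ := geodesicFrom n f z with hγdef
    refine ⟨γ, hγ, fun δ hδ => ⟨fun h => ?_, ?_⟩⟩
    · have h1 := eq_of_tangencyIntegral_eq hf hz (hδ.phase_mem_unitTangent hf 0)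
        (fun k => (h k).symm)
      have h2 := h1.2 hI
      rw [← hγ0, tangencyPoint_phase hf hγ, tangencyPoint_phase hf hδ] at h2
      set a := -⟪γ 0, deriv γ 0⟫
      set b := -⟪δ 0, deriv δ 0⟫
      have h3 := (hγ.comp_add_const a).eq_of_phase_eq hf (hδ.comp_add_const b)
        (by rw [phase_comp_add_const, phase_comp_add_const, zero_add, zero_add, h2])
      refine ⟨a - b, fun s => ?_⟩
      have h4 := congrFun h3 (s - b)
      simp only [sub_add_cancel] at h4
      rw [← h4]
      congr 1
      ring
    · rintro ⟨c, hc⟩ k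
      have h1 : δ = fun s => γ (s + c) := funext hc
      rw [h1, phase_comp_add_const, isFirstIntegral_tangencyIntegral hf k γ hγ, hγ0]
  · rintro ⟨hγ, h0⟩
    have h1 := norm_tangencyPoint hf (hγ.phase_mem_unitTangent hf 0)
    have h2 : distSq (phase γ 0) • tangencyPoint n f (phase γ 0) = 0 :=
      eq_of_forall_phaseCoord_eq fun k => by
        rw [map_smul, map_zero]
        exact h0 k
    refine hγ.isRadial_of_distSq_eq_zero ((smul_eq_zero.1 h2).resolve_right fun h3 => ?_)
    rw [h3] at h1
    simp at h1
  · intro h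
    exact ⟨h.isUnitGeodesic, fun k => by rw [tangencyIntegral, h.distSq_phase, zero_mul]⟩
  · intro γ hγ hr
    have hpos : 0 < distSq (phase γ 0) :=
      lt_of_le_of_ne hγ.distSq_phase_nonneg fun h => hr (hγ.isRadial_of_distSq_eq_zero h.symm)
    refine ⟨hpos, hγ.distSq_phase, -⟪γ 0, deriv γ 0⟫, fun s => ⟨?_, ?_⟩, fun j => ?_⟩
    · rintro ⟨-, h⟩
      rw [(hγ.conservation s).1] at h
      linarith
    · rintro rfl
      obtain ⟨h1, h2⟩ := hγ.conservation (-⟪γ 0, deriv γ 0⟫)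
      rw [neg_add_cancel] at h1 h2
      refine ⟨?_, h1⟩
      rw [eq_comm, Real.sqrt_eq_iff_mul_self_eq hγ.distSq_phase_nonneg (norm_nonneg _), ← sq, h2]
      ring
    · rw [tangencyIntegral, tangencyIntegral, tangencyPoint_phase hf hγ, phaseCoord_position,
        phaseCoord_velocity]
      exact ⟨rfl, rfl⟩
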